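/- Write $\|f\|=\max_{\varphi\in[0,2\pi]}|f(\varphi)|$ and $\|f\|_1=\int_0^{2\pi}|f(\varphi)|\,d\varphi$, and let $l\in\mathbb N_0$. (a) For every $\varepsilon>0$ and every $M\ge 0$ there is $n_0=n_0(\varepsilon,l,M)\ge l$ such that for all $n\ge n_0$, all $\mu_0,\dots,\mu_n\in\mathbb C$ with $|\mu_j|\le M$ for $0\le j\le l$, and all $\tau_0,\dots,\tau_n\in\mathbb C$, $$4\,\Big\|\operatorname{Re}\sum_{j=0}^{l}\mu_{l-j}\tau_j e^{i(n-j)\varphi}\Big\|\le\Big(\Big\|\operatorname{Re}\sum_{j=0}^{n}\mu_j e^{i(n-j)\varphi}\Big\|_1+\varepsilon\Big)\Big\|\operatorname{Re}\sum_{j=0}^{n}\overline{\tau_j}\,e^{i(n-j)\varphi}\Big\| .$$ (b) For real data the estimate is asymptotically sharp: for every nonzero $(\mu_0,\dots,\mu_l)\in\mathbb R^{l+1}$ there is $(\tau_0,\dots,\tau_l)\in\mathbb R^{l+1}$, and conversely for every nonzero $(\tau_0,\dots,\tau_l)\in\mathbb R^{l+1}$ there is $(\mu_0,\dots,\mu_l)\in\mathbb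 R^{l+1}$, such that, for a suitable choice, for each $n$, of the remaining coefficients $\mu_j=\mu_j^{(n)}\in\mathbb R$ and $\tau_j=\tau_j^{(n)}\in\mathbb R$ $(l+1\le j\le n)$, $$\lim_{n\to\infty}\frac{4\,\big\|\operatorname{Re}\sum_{j=0}^{l}\mu_{l-j}\tau_j e^{i(n-j)\varphi}\big\|}{\big\|\operatorname{Re}\sum_{j=0}^{n}\mu_j e^{i(n-j)\varphi}\big\|_1\;\big\|\operatorname{Re}\sum_{j=0}^{n}\overline{\tau_j}\,e^{i(n-j)\varphi}\big\|}=1 .$$ -/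

import Mathlib

open scoped ComplexConjugate Topology

noncomputable section

/-- The real trigonometric polynomial `φ ↦ Re (∑_{j=0}^{m} c_j e^{i (n - j) φ})`. -/
def reTrigPoly (n m : ℕ) (c : ℕ → ℂ) (φ : ℝ) : ℝ :=
  (∑ j ∈ Finset.range (m + 1), c j * Complex.exp (((n : ℂ) - (j : ℂ)) * (φ : ℂ) * Complex.I)).re

/-- The maximum norm on `[0, 2π]` (used for continuous functions only). -/
def supNorm (f : ℝ → ℝ) : ℝ :=
  ⨆ φ : Set.Icc (0 : ℝ) (2 * Real.pi), |f φ|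

/-- The norm `∫_0^{2π} |f(φ)| dφ` (used for continuous functions only). -/
def l1Norm (f : ℝ → ℝ) : ℝ :=
  ∫ φ in (0 : ℝ)..(2 * Real.pi), |f φ|

/-- `‖Re ∑_{j=0}^{l} μ_{l-j} τ_j e^{i (n - j) φ}‖`, maximum norm. -/
def productNorm (l n : ℕ) (μ τ : ℕ → ℂ) : ℝ :=
  supNorm (reTrigPoly n l (fun j => μ (l - j) * τ j))

/-- `‖Re ∑_{j=0}^{n} μ_j e^{i (n - j) φ}‖₁`. -/
def muNorm (n : ℕ) (μ : ℕ → ℂ) : ℝ :=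
  l1Norm (reTrigPoly n n μ)

/-- `‖Re ∑_{j=0}^{n} conj τ_j e^{i (n - j) φ}‖`, maximum norm. -/
def tauNorm (n : ℕ) (τ : ℕ → ℂ) : ℝ :=
  supNorm (reTrigPoly n n (fun j => conj (τ j)))

/-- For the real leading coefficients `a = (μ_0, …, μ_l)` and `b = (τ_0, …, τ_l)`, which do not
depend on `n`, one can choose for every `n` the remaining real coefficients
`μ_{l+1}, …, μ_n` and `τ_{l+1}, …, τ_n` in such a way that the quotient of
`4 ‖Re ∑_{j≤l} μ_{l-j} τ_j e^{i(n-j)φ}‖` by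
`‖Re ∑_{j≤n} μ_j e^{i(n-j)φ}‖₁ ‖Re ∑_{j≤n} conj τ_j e^{i(n-j)φ}‖` tends to `1`. -/
def AsymptoticallySharp (l : ℕ) (a b : Fin (l + 1) → ℝ) : Prop :=
  ∃ μ τ : ℕ → ℕ → ℝ,
    (∀ (n : ℕ) (j : Fin (l + 1)), μ n j = a j ∧ τ n j = b j) ∧
    Filter.Tendsto
      (fun n : ℕ =>
        4 * productNorm l n (fun j => (μ n j : ℂ)) (fun j => (τ n j : ℂ)) /
          (muNorm n (fun j => (μ n j : ℂ)) * tauNorm n (fun j => (τ n j : ℂ))))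
      Filter.atTop (𝓝 1)

end

/-!
Throughout `z = e^{it}`, `A = Re ∑ μ_j z^{n-j}` and `B = Re ∑ conj τ_j z^{n-j}`.

*The inequality.* Suppose `G` is a polynomial with `G_j = conj τ_j` for `j ≤ l` and `|G| ≤ S` on the
unit circle. Since `(4 / π) arctan w = (4 / π) (w - w³ / 3 + ⋯)` maps the unit disc into the strip
`|Re| ≤ 1`, the function `h = S Re (4 / π) arctan (z^{n-l} G(z) / S)` satisfies `|h| ≤ S`. The
cubic and higher terms have frequencies at least `3 (n - l) > n`, hence are orthogonal to `A`, and
the linear term gives `∫ A h = 4 Re ∑_{j ≤ l} μ_{l-j} τ_j` (`integral_reTrigPoly_mul_arctan`). So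
`4 |Re ∑_{j ≤ l} μ_{l-j} τ_j| ≤ S ‖A‖₁`, and translations reach every point `φ`.

A suitable `G` with `S = (1 + δ) ‖B‖` exists for large `n`
(`exists_polynomial_of_abs_reTrigPoly_le`): sampling `B` with alternating signs along an arithmetic
progression of step `π / n`, with Fejér weights of fixed order `m`, demodulates the carrier `z^n` at
no cost in norm, and a shift of the progression by `β / n` turns the phase of the carrier by `β`
while the Fejér mean of order `m` hardly changes. The relative error `δ` becomes the additive `ε`
because a crude bound proves the claim when `‖A‖₁` is large compared with `M`.

*Sharpness.* Let `⟨a, b⟩ = ∑ a_{l-j} b_j`. The smallest normalized `L¹` norm `N₁(a)` of a polynomial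
starting with `a` and the smallest supremum norm `N(b)` of a polynomial starting with `b` are dual
to each other under this pairing. For given `a`, Hahn–Banach yields a functional `Λ` with
`Λ ≤ ‖·‖₁` which vanishes on the multiples of `X ^ (l + 1)` and norms `a`; the numbers
`b_j = Λ (z^{l-j})` are the initial coefficients of a series whose Fejér means are bounded by one
(`exists_fejer_mean`). For given `b` the same construction with the supremum norm gives `a`, and the
first case applied to `a` shows `N₁(a) ≤ 1`. Near-minimizers `f` and `g` for such an extremal pair
serve as the coefficients `μ` and `τ`: then `‖B‖ ≤ max |g|`, while `‖A‖₁` is at most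
`(2 / π) ∫ |f| + O(1 / n)` because the mean of `|cos|` is `2 / π` (`exists_muNorm_coeff_le`).
-/

/-! ### Trigonometric polynomials and their coefficients -/

lemma conj_circleExp (t : ℝ) : conj (Circle.exp t : ℂ) = (Circle.exp t : ℂ)⁻¹ :=
  (Circle.coe_inv_eq_conj _).symm.trans (Circle.coe_inv _)

lemma continuous_circleExp_coe : Continuous fun t : ℝ => (Circle.exp t : ℂ) := by
  simp only [Circle.coe_exp]; fun_prop

lemma continuous_circleExp_zpow (k : ℤ) : Continuous fun t : ℝ => (Circle.exp t : ℂ) ^ k :=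
  continuous_circleExp_coe.zpow₀ k fun _ => Or.inl (Circle.coe_ne_zero _)

lemma circleExp_periodic : Function.Periodic (fun t : ℝ => (Circle.exp t : ℂ)) (2 * Real.pi) := by
  intro _; simp

lemma integral_circleExp_zpow (k : ℤ) :
    ∫ t in (0 : ℝ)..(2 * Real.pi), (Circle.exp t : ℂ) ^ k =
      if k = 0 then 2 * (Real.pi : ℂ) else 0 := by
  split_ifs with hk
  · simp [hk]
  · have hc : (k : ℂ) * Complex.I ≠ 0 := mul_ne_zero (by exact_mod_cast hk) Complex.I_ne_zero
    have h : ∀ t : ℝ, (Circle.exp t : ℂ) ^ k = Complex.exp (((k : ℂ) * Complex.I) * t) := by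
      intro t
      rw [Circle.coe_exp, ← Complex.exp_int_mul]
      ring_nf
    simp_rw [h]
    rw [integral_exp_mul_complex hc]
    have : (k : ℂ) * Complex.I * ((2 * Real.pi : ℝ) : ℂ) = k * (2 * Real.pi * Complex.I) := by
      push_cast; ring
    rw [this, Complex.exp_int_mul_two_pi_mul_I]
    simp

lemma reTrigPoly_eq {n m : ℕ} (hmn : m ≤ n) (c : ℕ → ℂ) (t : ℝ) :
    reTrigPoly n m c t = (∑ j ∈ Finset.range (m + 1), c j * (Circle.exp t : ℂ) ^ (n - j)).re := by
  unfold reTrigPoly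
  congr 1
  refine Finset.sum_congr rfl fun j hj => ?_
  have hj : j ≤ n := by simp at hj; omega
  rw [Circle.coe_exp, ← Complex.exp_nat_mul, Nat.cast_sub hj]
  ring_nf

lemma continuous_reTrigPoly (n m : ℕ) (c : ℕ → ℂ) : Continuous (reTrigPoly n m c) := by
  unfold reTrigPoly; fun_prop

lemma reTrigPoly_periodic {n m : ℕ} (hmn : m ≤ n) (c : ℕ → ℂ) :
    Function.Periodic (reTrigPoly n m c) (2 * Real.pi) := by
  intro t
  simp only [reTrigPoly_eq hmn, circleExp_periodic t]

lemma abs_le_supNorm {f : ℝ → ℝ} (hf : Continuous f) (hp : Function.Periodic f (2 * Real.pi))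
    (t : ℝ) : |f t| ≤ supNorm f := by
  obtain ⟨y, hy, hxy⟩ := hp.exists_mem_Ico₀ Real.two_pi_pos t
  rw [hxy]
  have hbdd : BddAbove (Set.range fun φ : Set.Icc (0 : ℝ) (2 * Real.pi) => |f φ|) := by
    have := (isCompact_Icc (a := (0 : ℝ)) (b := 2 * Real.pi)).bddAbove_image (f := fun x => |f x|)
      (by fun_prop)
    rwa [Set.image_eq_range] at this
  exact le_ciSup hbdd ⟨y, hy.1, hy.2.le⟩

lemma supNorm_le {f : ℝ → ℝ} {C : ℝ} (h : ∀ t, |f t| ≤ C) : supNorm f ≤ C := by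
  have : Nonempty (Set.Icc (0 : ℝ) (2 * Real.pi)) := ⟨⟨0, le_rfl, Real.two_pi_pos.le⟩⟩
  exact ciSup_le fun φ => h φ

lemma supNorm_nonneg (f : ℝ → ℝ) : 0 ≤ supNorm f := Real.iSup_nonneg fun _ => abs_nonneg _

lemma l1Norm_nonneg (f : ℝ → ℝ) : 0 ≤ l1Norm f :=
  intervalIntegral.integral_nonneg Real.two_pi_pos.le fun _ _ => abs_nonneg _

lemma Polynomial.continuous_eval_circleExp (Q : Polynomial ℂ) :
    Continuous fun t : ℝ => Q.eval (Circle.exp t : ℂ) :=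
  Q.continuous.comp continuous_circleExp_coe

/-- Pairing a real trigonometric polynomial with a polynomial that vanishes at the origin. -/
lemma integral_reTrigPoly_mul_eval (n : ℕ) (μ : ℕ → ℂ) (Q : Polynomial ℂ) (hQ : Q.coeff 0 = 0) :
    ∫ t in (0 : ℝ)..(2 * Real.pi), (reTrigPoly n n μ t : ℂ) * Q.eval (Circle.exp t : ℂ) =
      Real.pi * ∑ j ∈ Finset.range (n + 1), conj (μ j) * Q.coeff (n - j) := by
  have key : ∀ j ∈ Finset.range (n + 1), ∀ q ∈ Finset.range (Q.natDegree + 1),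
      ∫ t in (0 : ℝ)..(2 * Real.pi),
        ((μ j * Q.coeff q / 2) * (Circle.exp t : ℂ) ^ ((n - j + q : ℕ) : ℤ) +
          (conj (μ j) * Q.coeff q / 2) * (Circle.exp t : ℂ) ^ ((q : ℤ) - (n - j : ℕ))) =
        if q = n - j then Real.pi * (conj (μ j) * Q.coeff q) else 0 := by
    intro j hj q hq
    rw [intervalIntegral.integral_add, intervalIntegral.integral_const_mul,
      intervalIntegral.integral_const_mul, integral_circleExp_zpow, integral_circleExp_zpow]
    · rcases Nat.eq_zero_or_pos q with rfl | hq0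
      · simp [hQ]
      · have h1 : ((n - j + q : ℕ) : ℤ) ≠ 0 := by omega
        rw [if_neg h1]
        by_cases h : q = n - j
        · rw [if_pos h, if_pos (by omega)]
          ring
        · rw [if_neg h, if_neg (by omega)]
          ring
    · exact (continuous_const.mul (continuous_circleExp_zpow _)).intervalIntegrable _ _
    · exact (continuous_const.mul (continuous_circleExp_zpow _)).intervalIntegrable _ _
  have expand : ∀ t : ℝ, (reTrigPoly n n μ t : ℂ) * Q.eval (Circle.exp t : ℂ) =
      ∑ j ∈ Finset.range (n + 1), ∑ q ∈ Finset.range (Q.natDegree + 1),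
        ((μ j * Q.coeff q / 2) * (Circle.exp t : ℂ) ^ ((n - j + q : ℕ) : ℤ) +
          (conj (μ j) * Q.coeff q / 2) * (Circle.exp t : ℂ) ^ ((q : ℤ) - (n - j : ℕ))) := by
    intro t
    have hz : (Circle.exp t : ℂ) ≠ 0 := Circle.coe_ne_zero _
    rw [reTrigPoly_eq le_rfl, Complex.re_eq_add_conj, Polynomial.eval_eq_sum_range, map_sum,
      ← Finset.sum_add_distrib, Finset.sum_div, Finset.sum_mul_sum]
    refine Finset.sum_congr rfl fun j _ => Finset.sum_congr rfl fun q _ => ?_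
    rw [map_mul, map_pow, conj_circleExp, zpow_sub₀ hz, zpow_natCast, zpow_natCast, zpow_natCast,
      pow_add, inv_pow]
    ring
  simp_rw [expand]
  rw [intervalIntegral.integral_finsetSum, Finset.mul_sum]
  · refine Finset.sum_congr rfl fun j hj => ?_
    rw [intervalIntegral.integral_finsetSum, Finset.sum_congr rfl (key j hj), Finset.sum_ite_eq']
    · split_ifs with h
      · rfl
      · rw [Polynomial.coeff_eq_zero_of_natDegree_lt (by rw [Finset.mem_range] at h; omega)]
        simp
    · intro q _
      exact ((continuous_const.mul (continuous_circleExp_zpow _)).add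
        (continuous_const.mul (continuous_circleExp_zpow _))).intervalIntegrable _ _
  · intro j _
    exact (continuous_finsetSum _ fun q _ =>
      ((continuous_const.mul (continuous_circleExp_zpow _)).add
        (continuous_const.mul (continuous_circleExp_zpow _)))).intervalIntegrable _ _

lemma norm_integral_reTrigPoly_mul_circleExp_pow {n j : ℕ} (hj : j < n) (μ : ℕ → ℂ) :
    Real.pi * ‖μ j‖ = ‖∫ t in (0 : ℝ)..(2 * Real.pi),
      (reTrigPoly n n μ t : ℂ) * (Circle.exp t : ℂ) ^ (n - j)‖ := by
  have h := integral_reTrigPoly_mul_eval n μ (Polynomial.X ^ (n - j))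
    (by rw [Polynomial.coeff_X_pow, if_neg (by omega)])
  simp only [Polynomial.eval_pow, Polynomial.eval_X, Polynomial.coeff_X_pow] at h
  rw [h, Finset.sum_eq_single j]
  · simp [abs_of_pos Real.pi_pos]
  · intro i hi hij
    rw [Finset.mem_range] at hi
    rw [if_neg (by omega), mul_zero]
  · intro h'; exact absurd (Finset.mem_range.2 (by omega)) h'

lemma pi_mul_norm_le_l1Norm {n j : ℕ} (hj : j < n) (μ : ℕ → ℂ) :
    Real.pi * ‖μ j‖ ≤ l1Norm (reTrigPoly n n μ) := by
  rw [norm_integral_reTrigPoly_mul_circleExp_pow hj]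
  refine (intervalIntegral.norm_integral_le_integral_norm Real.two_pi_pos.le).trans (le_of_eq ?_)
  simp [l1Norm]

lemma norm_le_two_mul_of_abs_reTrigPoly_le {n j : ℕ} (hj : j < n) {μ : ℕ → ℂ} {T : ℝ}
    (hT : ∀ t, |reTrigPoly n n μ t| ≤ T) : ‖μ j‖ ≤ 2 * T := by
  have h1 : l1Norm (reTrigPoly n n μ) ≤ 2 * Real.pi * T := by
    have := intervalIntegral.integral_mono_on (μ := MeasureTheory.volume) Real.two_pi_pos.le
      ((continuous_reTrigPoly n n μ).abs.intervalIntegrable _ _)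
      (continuous_const.intervalIntegrable _ _) fun t _ => hT t
    simpa [l1Norm] using this
  have h2 := pi_mul_norm_le_l1Norm hj μ
  have := Real.pi_pos
  nlinarith

/-! ### The arctangent kernel -/

lemma re_one_add_div_one_sub_pos {u : ℂ} (hu : ‖u‖ < 1) : 0 < ((1 + u) / (1 - u)).re := by
  have h3 : u.re * u.re + u.im * u.im < 1 := by
    rw [← Complex.normSq_apply, Complex.normSq_eq_norm_sq]
    nlinarith [norm_nonneg u]
  have h0 : 1 - u ≠ 0 := by
    intro h0
    rw [← sub_eq_zero.1 h0, norm_one] at hu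
    exact lt_irrefl _ hu
  rw [Complex.div_re, ← add_div]
  refine div_pos ?_ (Complex.normSq_pos.2 h0)
  simp only [Complex.add_re, Complex.one_re, Complex.sub_re, Complex.add_im, Complex.one_im,
    Complex.sub_im]
  nlinarith

/-- The arctangent maps the unit disc into the strip `|Re| ≤ π / 4`. -/
lemma abs_re_arctan_le {w : ℂ} (hw : ‖w‖ < 1) : |(Complex.arctan w).re| ≤ Real.pi / 4 := by
  have h1 : (Complex.arctan w).re = ((1 + w * Complex.I) / (1 - w * Complex.I)).arg / 2 := by
    rw [Complex.arctan, ← Complex.log_im, Complex.mul_re]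
    simp
    ring
  have h4 := Complex.abs_arg_le_pi_div_two_iff.2
    (re_one_add_div_one_sub_pos (u := w * Complex.I) (by simpa using hw)).le
  rw [h1, abs_div, abs_two]
  linarith

/-- The integral of the product sees only the linear term of the arctangent series: by
`n < 3 * (n - l)` the other terms contain only frequencies larger than `n`. -/
lemma integral_reTrigPoly_mul_arctan {l n : ℕ} (hln : l < n) (hn : n < 3 * (n - l)) (μ : ℕ → ℂ)
    (G : Polynomial ℂ) {r : ℝ} (hr : r < 1) (hG : ∀ t : ℝ, ‖G.eval (Circle.exp t : ℂ)‖ ≤ r) :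
    ∫ t in (0 : ℝ)..(2 * Real.pi), (reTrigPoly n n μ t : ℂ) *
        Complex.arctan ((Polynomial.X ^ (n - l) * G).eval (Circle.exp t : ℂ)) =
      Real.pi * ∑ j ∈ Finset.range (l + 1), conj (μ (l - j)) * G.coeff j := by
  set Q : Polynomial ℂ := Polynomial.X ^ (n - l) * G with hQ
  have hr0 : 0 ≤ r := (norm_nonneg _).trans (hG 0)
  have hQr : ∀ t : ℝ, ‖Q.eval (Circle.exp t : ℂ)‖ ≤ r := by
    intro t
    rw [hQ, Polynomial.eval_mul, norm_mul]
    simpa using hG t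
  have hpow : ∀ k : ℕ, Q ^ (2 * k + 1) =
      Polynomial.X ^ ((n - l) * (2 * k + 1)) * G ^ (2 * k + 1) := by
    intro k; rw [hQ, mul_pow, ← pow_mul]
  have hsum : HasSum (fun k : ℕ => ∫ t in (0 : ℝ)..(2 * Real.pi), (reTrigPoly n n μ t : ℂ) *
      ((-1) ^ k * (Q.eval (Circle.exp t : ℂ)) ^ (2 * k + 1) / ((2 * k + 1 : ℕ) : ℂ)))
      (∫ t in (0 : ℝ)..(2 * Real.pi), (reTrigPoly n n μ t : ℂ) *
        Complex.arctan (Q.eval (Circle.exp t : ℂ))) := by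
    have hgeom : Summable fun k : ℕ => r ^ (2 * k + 1) := by
      have h := (summable_geometric_of_lt_one (sq_nonneg r)
        (by nlinarith : r ^ 2 < 1)).mul_right r
      simpa only [pow_succ, pow_mul] using h
    have hA := Complex.continuous_ofReal.comp (continuous_reTrigPoly n n μ)
    refine intervalIntegral.hasSum_integral_of_dominated_convergence
      (fun k t => |reTrigPoly n n μ t| * r ^ (2 * k + 1)) ?_ ?_ ?_ ?_ ?_
    · intro k
      refine Continuous.aestronglyMeasurable (hA.mul (Continuous.div_const (Continuous.mul
        continuous_const ((Polynomial.continuous_eval_circleExp Q).pow _)) _))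
    · intro k
      refine Filter.Eventually.of_forall fun t _ => ?_
      rw [norm_mul, Complex.norm_real, Real.norm_eq_abs]
      refine mul_le_mul_of_nonneg_left ?_ (abs_nonneg _)
      rw [norm_div, norm_mul, norm_pow, norm_neg, norm_one, one_pow, one_mul, norm_pow,
        Complex.norm_natCast]
      refine (div_le_self (by positivity) (by norm_cast; omega)).trans ?_
      exact pow_le_pow_left₀ (norm_nonneg _) (hQr t) _
    · exact Filter.Eventually.of_forall fun t _ => hgeom.mul_left _
    · simp_rw [tsum_mul_left]
      exact ((continuous_reTrigPoly n n μ).abs.mul continuous_const).intervalIntegrable _ _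
    · refine Filter.Eventually.of_forall fun t _ => ?_
      exact (Complex.hasSum_arctan ((hQr t).trans_lt hr)).mul_left _
  have hterm : ∀ k : ℕ, ∫ t in (0 : ℝ)..(2 * Real.pi), (reTrigPoly n n μ t : ℂ) *
      ((-1) ^ k * (Q.eval (Circle.exp t : ℂ)) ^ (2 * k + 1) / ((2 * k + 1 : ℕ) : ℂ)) =
      (-1) ^ k / ((2 * k + 1 : ℕ) : ℂ) * (Real.pi * ∑ j ∈ Finset.range (n + 1),
        conj (μ j) * (Q ^ (2 * k + 1)).coeff (n - j)) := by
    intro k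
    rw [← integral_reTrigPoly_mul_eval n μ (Q ^ (2 * k + 1)), ←
      intervalIntegral.integral_const_mul]
    · congr 1
      ext t
      rw [Polynomial.eval_pow]
      ring
    · rw [hpow, Polynomial.coeff_X_pow_mul', if_neg]
      have : 0 < (n - l) * (2 * k + 1) := Nat.mul_pos (by omega) (by omega)
      omega
  have hzero : ∀ k : ℕ, k ≠ 0 → ∫ t in (0 : ℝ)..(2 * Real.pi), (reTrigPoly n n μ t : ℂ) *
      ((-1) ^ k * (Q.eval (Circle.exp t : ℂ)) ^ (2 * k + 1) / ((2 * k + 1 : ℕ) : ℂ)) = 0 := by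
    intro k hk
    rw [hterm, Finset.sum_eq_zero, mul_zero, mul_zero]
    intro j _
    rw [hpow, Polynomial.coeff_X_pow_mul', if_neg, mul_zero]
    have : (n - l) * 3 ≤ (n - l) * (2 * k + 1) := Nat.mul_le_mul_left _ (by omega)
    omega
  rw [hsum.unique (hasSum_single 0 hzero), hterm 0]
  simp only [pow_zero, mul_zero, zero_add, Nat.cast_one, div_one, one_mul, pow_one]
  congr 1
  have hsub : Finset.range (l + 1) ⊆ Finset.range (n + 1) := by
    intro j; simp only [Finset.mem_range]; omega
  rw [← Finset.sum_subset hsub, ← Finset.sum_range_reflect]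
  · refine Finset.sum_congr rfl fun j hj => ?_
    rw [Finset.mem_range] at hj
    rw [hQ, Polynomial.coeff_X_pow_mul', if_pos (by omega)]
    congr 3
    all_goals omega
  · intro j _ hj
    rw [Finset.mem_range] at hj
    rw [hQ, Polynomial.coeff_X_pow_mul', if_neg (by rw [Finset.mem_range] at *; omega), mul_zero]

/-- Testing the trigonometric polynomial against the real part of
`arctan (z ^ (n - l) * G z / R)`, for every `R > S`. -/
lemma four_mul_abs_re_sum_le {l n : ℕ} (hln : l < n) (hn : n < 3 * (n - l)) (μ : ℕ → ℂ)
    (G : Polynomial ℂ) {S : ℝ} (hG : ∀ t : ℝ, ‖G.eval (Circle.exp t : ℂ)‖ ≤ S) :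
    4 * |(∑ j ∈ Finset.range (l + 1), conj (μ (l - j)) * G.coeff j).re| ≤
      S * l1Norm (reTrigPoly n n μ) := by
  have hS : 0 ≤ S := (norm_nonneg _).trans (hG 0)
  have hN := l1Norm_nonneg (reTrigPoly n n μ)
  have key : ∀ R : ℝ, S < R →
      4 * |(∑ j ∈ Finset.range (l + 1), conj (μ (l - j)) * G.coeff j).re| ≤
        R * l1Norm (reTrigPoly n n μ) := by
    intro R hR
    have hR0 : 0 < R := hS.trans_lt hR
    have hG' : ∀ t : ℝ, ‖(Polynomial.C ((R⁻¹ : ℝ) : ℂ) * G).eval (Circle.exp t : ℂ)‖ ≤ S / R := by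
      intro t
      rw [Polynomial.eval_mul, Polynomial.eval_C, norm_mul, Complex.norm_real, Real.norm_eq_abs,
        abs_of_pos (inv_pos.2 hR0), div_eq_inv_mul]
      exact mul_le_mul_of_nonneg_left (hG t) (inv_pos.2 hR0).le
    have hlt : S / R < 1 := (div_lt_one hR0).2 hR
    have h := integral_reTrigPoly_mul_arctan hln hn μ _ hlt hG'
    set w : ℝ → ℂ := fun t => (Polynomial.X ^ (n - l) *
      (Polynomial.C ((R⁻¹ : ℝ) : ℂ) * G)).eval (Circle.exp t : ℂ) with hw
    have hw1 : ∀ t, ‖w t‖ < 1 := by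
      intro t
      rw [hw]
      simp only [Polynomial.eval_mul (p := Polynomial.X ^ (n - l)), norm_mul]
      refine lt_of_le_of_lt ?_ hlt
      simpa using hG' t
    have hwc : Continuous w := Polynomial.continuous_eval_circleExp _
    have hac : Continuous fun t => Complex.arctan (w t) := by
      unfold Complex.arctan
      refine continuous_const.mul (Continuous.clog ?_ ?_)
      · refine Continuous.div (by fun_prop) (by fun_prop) ?_
        intro t h0
        have : ‖w t * Complex.I‖ = 1 := by rw [← sub_eq_zero.1 h0, norm_one]
        rw [norm_mul, Complex.norm_I, mul_one] at this
        exact (hw1 t).ne this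
      · intro t
        exact Or.inl (re_one_add_div_one_sub_pos (by simpa using hw1 t))
    have hre : Real.pi / R * (∑ j ∈ Finset.range (l + 1), conj (μ (l - j)) * G.coeff j).re =
        ∫ t in (0 : ℝ)..(2 * Real.pi), reTrigPoly n n μ t * (Complex.arctan (w t)).re := by
      have h1 := congrArg Complex.re h
      have h2 := Complex.reCLM.intervalIntegral_comp_comm (a := 0) (b := 2 * Real.pi)
        (μ := MeasureTheory.volume)
        (f := fun t => (reTrigPoly n n μ t : ℂ) * Complex.arctan (w t))
        (((Complex.continuous_ofReal.comp (continuous_reTrigPoly n n μ)).mul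
          hac).intervalIntegrable _ _)
      simp only [Complex.reCLM_apply, Complex.re_ofReal_mul] at h2
      rw [h2]
      rw [h1]
      simp only [Polynomial.coeff_C_mul]
      rw [Complex.re_ofReal_mul]
      have : ∑ j ∈ Finset.range (l + 1), conj (μ (l - j)) * (((R⁻¹ : ℝ) : ℂ) * G.coeff j) =
          ((R⁻¹ : ℝ) : ℂ) * ∑ j ∈ Finset.range (l + 1), conj (μ (l - j)) * G.coeff j := by
        rw [Finset.mul_sum]; exact Finset.sum_congr rfl fun j _ => by ring
      rw [this, Complex.re_ofReal_mul]
      ring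
    have hbound : |∫ t in (0 : ℝ)..(2 * Real.pi),
        reTrigPoly n n μ t * (Complex.arctan (w t)).re| ≤
        l1Norm (reTrigPoly n n μ) * (Real.pi / 4) := by
      rw [l1Norm, ← intervalIntegral.integral_mul_const, ← Real.norm_eq_abs]
      refine intervalIntegral.norm_integral_le_of_norm_le Real.two_pi_pos.le ?_ ?_
      · refine Filter.Eventually.of_forall fun t _ => ?_
        rw [norm_mul]
        exact mul_le_mul_of_nonneg_left (abs_re_arctan_le (hw1 t)) (norm_nonneg _)
      · exact ((continuous_reTrigPoly n n μ).abs.mul continuous_const).intervalIntegrable _ _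
    rw [← hre, abs_mul, abs_of_pos (div_pos Real.pi_pos hR0), div_mul_eq_mul_div,
      div_le_iff₀ hR0] at hbound
    have := Real.pi_pos
    nlinarith
  refine le_of_forall_pos_le_add fun ε hε => ?_
  refine (key (S + ε / (l1Norm (reTrigPoly n n μ) + 1))
    (lt_add_of_pos_right _ (by positivity))).trans ?_
  rw [add_mul]
  gcongr
  rw [div_mul_eq_mul_div, div_le_iff₀ (by positivity)]
  nlinarith

/-! ### Demodulation by Fejér weights and the upper estimate -/

/-- Discrete Fejér weights: averaging the characters `k ↦ e^{-i j k π / n}` of `ℤ / 2n` against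
`|∑_{a<m} e^{i a k π / n}|²`. -/
lemma sum_fejer_weight_mul_pow {m n j : ℕ} (hn : 0 < n) (hm : m ≤ n) (hj : j ≤ n) :
    ∑ k ∈ Finset.range (2 * n), ((‖∑ a ∈ Finset.range m,
        (Circle.exp (a * k * (Real.pi / n)) : ℂ)‖ ^ 2 : ℝ) : ℂ) *
          (Circle.exp (-(j * k * (Real.pi / n))) : ℂ) = 2 * n * ((m - j : ℕ) : ℂ) := by
  have hsq : ∀ k : ℕ, ((‖∑ a ∈ Finset.range m,
      (Circle.exp (a * k * (Real.pi / n)) : ℂ)‖ ^ 2 : ℝ) : ℂ) *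
        (Circle.exp (-(j * k * (Real.pi / n))) : ℂ) =
      ∑ b ∈ Finset.range m, ∑ a ∈ Finset.range m,
        (Circle.exp ((a - b - j) * (Real.pi / n)) : ℂ) ^ k := by
    intro k
    rw [Complex.ofReal_pow, ← Complex.conj_mul', map_sum, Finset.sum_mul_sum, Finset.sum_mul]
    refine Finset.sum_congr rfl fun b _ => ?_
    rw [Finset.sum_mul]
    refine Finset.sum_congr rfl fun a _ => ?_
    rw [← Circle.coe_inv_eq_conj, ← Circle.exp_neg, ← Circle.coe_mul, ← Circle.coe_mul,
      ← Circle.exp_add, ← Circle.exp_add, ← Circle.coe_pow, ← Circle.exp_nsmul, nsmul_eq_mul]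
    congr 2
    ring
  have hsum : ∀ b ∈ Finset.range m, ∀ a ∈ Finset.range m, ∑ k ∈ Finset.range (2 * n),
      (Circle.exp ((a - b - j) * (Real.pi / n)) : ℂ) ^ k = if a = b + j then 2 * (n : ℂ) else 0 := by
    intro b hb a ha
    rw [Finset.mem_range] at hb ha
    have hn' : (n : ℝ) ≠ 0 := by exact_mod_cast hn.ne'
    split_ifs with h
    · subst h
      simp
    -- As `|a - b - j| < 2 n`, this is the sum of a nontrivial character of `ℤ / 2n`.
    · have hone : (Circle.exp ((a - b - j) * (Real.pi / n)) : ℂ) ^ (2 * n) = 1 := by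
        rw [← Circle.coe_pow, ← Circle.exp_nsmul, nsmul_eq_mul]
        have : ((2 * n : ℕ) : ℝ) * ((a - b - j) * (Real.pi / n)) =
            ((a - b - j : ℤ) : ℝ) * (2 * Real.pi) := by
          push_cast; field_simp
        rw [this, Circle.exp_int_mul_two_pi, Circle.coe_one]
      have hne : (Circle.exp ((a - b - j) * (Real.pi / n)) : ℂ) ≠ 1 := by
        intro h1
        rw [Circle.coe_eq_one, Circle.exp_eq_one] at h1
        obtain ⟨q, hq⟩ := h1
        have h2 : ((a : ℤ) - b - j : ℤ) = q * (2 * n) := by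
          have h3 : ((a : ℝ) - b - j) * Real.pi = q * (2 * n) * Real.pi := by
            field_simp at hq; rw [hq]; ring
          have h4 := mul_right_cancel₀ Real.pi_ne_zero h3
          exact_mod_cast h4
        have hq0 : q ≠ 0 := by
          rintro rfl
          omega
        have h5 : (2 * n : ℤ) ∣ (a : ℤ) - b - j := ⟨q, by rw [h2]; ring⟩
        have h6 : (a : ℤ) - b - j = 0 := by
          refine Int.eq_zero_of_abs_lt_dvd h5 ?_
          rw [abs_lt]
          omega
        omega
      have := mul_neg_geom_sum (Circle.exp ((a - b - j) * (Real.pi / n)) : ℂ) (2 * n)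
      rw [hone, sub_self, mul_eq_zero] at this
      exact this.resolve_left (sub_ne_zero.2 hne.symm)
  simp_rw [hsq]
  rw [Finset.sum_comm]
  have : ∀ b ∈ Finset.range m, ∑ k ∈ Finset.range (2 * n), ∑ a ∈ Finset.range m,
      (Circle.exp ((a - b - j) * (Real.pi / n)) : ℂ) ^ k =
      if b < m - j then (2 * n : ℂ) else 0 := by
    intro b hb
    rw [Finset.sum_comm, Finset.sum_congr rfl (hsum b hb), Finset.sum_ite_eq']
    refine if_congr ?_ rfl rfl
    rw [Finset.mem_range]
    omega
  rw [Finset.sum_congr rfl this, ← Finset.sum_filter, Finset.sum_const, nsmul_eq_mul, mul_comm]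
  congr 2
  rw [show (Finset.range m).filter (· < m - j) = Finset.range (m - j) by
    ext b; simp only [Finset.mem_filter, Finset.mem_range]; omega, Finset.card_range]

lemma norm_circleExp_sub_one_le (x : ℝ) : ‖(Circle.exp x : ℂ) - 1‖ ≤ |x| := by
  rw [Circle.coe_exp, mul_comm]
  exact Real.norm_exp_I_mul_ofReal_sub_one_le

/-- Fejér means of the amplitude, read off from the real polynomial at arithmetic progressions of
step `π / n`, along which the carrier `e^{inφ}` alternates in sign. -/
lemma norm_fejer_sum_le {m n : ℕ} (hm0 : 0 < m) (hm : m ≤ n) {c : ℕ → ℂ} {T : ℝ}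
    (hT : ∀ t, |reTrigPoly n n c t| ≤ T) (θ : ℝ) :
    ‖∑ j ∈ Finset.range m, ((m - j : ℕ) / m : ℂ) * (c j * (Circle.exp θ : ℂ) ^ j)‖ ≤
      T + 2 * T * m ^ 2 * Real.pi / n := by
  have hn : 0 < n := hm0.trans_le hm
  have hnR : (n : ℝ) ≠ 0 := by exact_mod_cast hn.ne'
  have hnC : (n : ℂ) ≠ 0 := by exact_mod_cast hn.ne'
  have hmC : (m : ℂ) ≠ 0 := by exact_mod_cast hm0.ne'
  have hT0 : 0 ≤ T := (abs_nonneg _).trans (hT 0)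
  set P : ℂ := ∑ j ∈ Finset.range m, ((m - j : ℕ) / m : ℂ) * (c j * (Circle.exp θ : ℂ) ^ j) with hP
  -- The phase shift `β` turns the value of the Fejér mean into a nonnegative real number.
  obtain ⟨β, hβ, hβP⟩ : ∃ β : ℝ, |β| ≤ Real.pi ∧
      (Circle.exp (β - n * θ) : ℂ) * P = ‖P‖ := by
    refine ⟨(conj P * (Circle.exp (n * θ) : ℂ)).arg, Complex.abs_arg_le_pi _, ?_⟩
    have h1 := Complex.norm_mul_exp_arg_mul_I (conj P * (Circle.exp (n * θ) : ℂ))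
    rw [norm_mul, Circle.norm_coe, mul_one, RCLike.norm_conj, ← Circle.coe_exp] at h1
    rcases eq_or_ne P 0 with h0 | h0
    · rw [h0]; simp
    · have h2 : (‖P‖ : ℂ) ≠ 0 := by simpa using h0
      refine mul_left_cancel₀ h2 ?_
      rw [Circle.exp_sub, Circle.coe_div, ← mul_assoc, mul_div_assoc', h1,
        mul_div_cancel_right₀ _ (Circle.coe_ne_zero _), Complex.conj_mul', sq]
  set tk : ℕ → ℝ := fun k => -θ + (β + Real.pi * k) / n with htk
  set w : ℕ → ℝ := fun k => ‖∑ a ∈ Finset.range m,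
        (Circle.exp (a * k * (Real.pi / n)) : ℂ)‖ ^ 2 / (2 * n * m) with hw
  have hw0 : ∀ k, 0 ≤ w k := fun k => by positivity
  have hwsum : ∀ j ≤ n, ∑ k ∈ Finset.range (2 * n), (w k : ℂ) *
      (Circle.exp (-(j * k * (Real.pi / n))) : ℂ) = (m - j : ℕ) / m := by
    intro j hj
    have h := sum_fejer_weight_mul_pow hn hm hj
    rw [eq_div_iff hmC]
    rw [mul_comm (2 * (n : ℂ)), ← div_eq_iff (by simpa using hnC)] at h
    rw [← h, Finset.sum_mul, Finset.sum_div]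
    refine Finset.sum_congr rfl fun k _ => ?_
    simp only [hw, Complex.ofReal_div]
    rw [Complex.ofReal_mul, Complex.ofReal_mul, Complex.ofReal_natCast, Complex.ofReal_natCast,
      Complex.ofReal_ofNat]
    generalize ((‖∑ a ∈ Finset.range m, (Circle.exp (a * k * (Real.pi / n)) : ℂ)‖ ^ 2 : ℝ) : ℂ) = x
    field_simp
  have hw1 : ∑ k ∈ Finset.range (2 * n), w k = 1 := by
    have h := hwsum 0 (Nat.zero_le n)
    simp only [Nat.cast_zero, zero_mul, neg_zero, Circle.exp_zero, Circle.coe_one, mul_one,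
      Nat.sub_zero, div_self hmC] at h
    exact_mod_cast h
  have havg : ∑ k ∈ Finset.range (2 * n), w k * ((-1) ^ k * reTrigPoly n n c (tk k)) =
      ((Circle.exp (β - n * θ) : ℂ) * ∑ j ∈ Finset.range m, ((m - j : ℕ) / m : ℂ) *
        (c j * (Circle.exp θ : ℂ) ^ j) * (Circle.exp (-(j * β / n)) : ℂ)).re := by
    have hext : ∑ j ∈ Finset.range m, ((m - j : ℕ) / m : ℂ) *
        (c j * (Circle.exp θ : ℂ) ^ j) * (Circle.exp (-(j * β / n)) : ℂ) =
        ∑ j ∈ Finset.range (n + 1), ((m - j : ℕ) / m : ℂ) *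
        (c j * (Circle.exp θ : ℂ) ^ j) * (Circle.exp (-(j * β / n)) : ℂ) := by
      refine Finset.sum_subset ?_ ?_
      · intro j; simp only [Finset.mem_range]; omega
      · intro j _ hj
        rw [Finset.mem_range, not_lt] at hj
        rw [Nat.sub_eq_zero_of_le hj]
        simp
    have hsign : ∀ k : ℕ, (((-1) ^ k : ℝ) : ℂ) = (Circle.exp (-(k * Real.pi)) : ℂ) := by
      intro k
      rw [Circle.exp_neg, ← nsmul_eq_mul, Circle.exp_nsmul, Circle.coe_inv, Circle.coe_pow,
        Circle.coe_exp, Complex.exp_pi_mul_I]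
      rcases Nat.even_or_odd k with hk | hk <;> simp [hk.neg_one_pow]
    rw [hext]
    have hterm : ∀ k : ℕ, w k * ((-1) ^ k * reTrigPoly n n c (tk k)) =
        ((Circle.exp (β - n * θ) : ℂ) * ∑ j ∈ Finset.range (n + 1),
          (c j * (Circle.exp θ : ℂ) ^ j) * (Circle.exp (-(j * β / n)) : ℂ) *
            ((w k : ℂ) * (Circle.exp (-(j * k * (Real.pi / n))) : ℂ))).re := by
      intro k
      rw [reTrigPoly_eq le_rfl, ← Complex.re_ofReal_mul, ← Complex.re_ofReal_mul, hsign,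
        Finset.mul_sum, Finset.mul_sum, Finset.mul_sum]
      congr 1
      refine Finset.sum_congr rfl fun j hj => ?_
      have hj : j ≤ n := by rw [Finset.mem_range] at hj; omega
      have hexp : Circle.exp (-(k * Real.pi)) * Circle.exp (tk k) ^ (n - j) =
          Circle.exp (β - n * θ) * (Circle.exp θ ^ j * Circle.exp (-(j * β / n)) *
            Circle.exp (-(j * k * (Real.pi / n)))) := by
        rw [← Circle.exp_nsmul, ← Circle.exp_nsmul, ← Circle.exp_add, ← Circle.exp_add,
          ← Circle.exp_add, ← Circle.exp_add, nsmul_eq_mul, nsmul_eq_mul, Nat.cast_sub hj]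
        congr 1
        simp only [htk]
        field_simp
        ring
      have hexp' := congrArg (fun x : Circle => (x : ℂ)) hexp
      simp only [Circle.coe_mul, Circle.coe_pow] at hexp'
      linear_combination ((w k : ℂ) * c j) * hexp'
    rw [Finset.sum_congr rfl fun k _ => hterm k, ← Complex.re_sum, ← Finset.mul_sum,
      Finset.sum_comm]
    congr 2
    refine Finset.sum_congr rfl fun j hj => ?_
    rw [← Finset.mul_sum, hwsum j (by rw [Finset.mem_range] at hj; omega)]
    ring
  have hle : ∑ k ∈ Finset.range (2 * n), w k * ((-1) ^ k * reTrigPoly n n c (tk k)) ≤ T := by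
    calc _ ≤ ∑ k ∈ Finset.range (2 * n), w k * T := by
          refine Finset.sum_le_sum fun k _ => mul_le_mul_of_nonneg_left ?_ (hw0 k)
          refine (le_abs_self _).trans ?_
          rw [abs_mul, abs_pow, abs_neg, abs_one, one_pow, one_mul]
          exact hT _
      _ = T := by rw [← Finset.sum_mul, hw1, one_mul]
  have herr : ‖P - ∑ j ∈ Finset.range m, ((m - j : ℕ) / m : ℂ) *
        (c j * (Circle.exp θ : ℂ) ^ j) * (Circle.exp (-(j * β / n)) : ℂ)‖ ≤
      2 * T * m ^ 2 * Real.pi / n := by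
    rw [hP, ← Finset.sum_sub_distrib]
    refine (norm_sum_le_of_le _ (n := fun _ => 2 * T * m * Real.pi / n) fun j hj => ?_).trans
      (le_of_eq ?_)
    · rw [Finset.mem_range] at hj
      rw [← mul_one_sub, norm_mul, norm_mul, norm_mul, norm_pow, Circle.norm_coe, one_pow, mul_one,
        norm_sub_rev]
      have h1 : ‖((m - j : ℕ) / m : ℂ)‖ ≤ 1 := by
        rw [norm_div, Complex.norm_natCast, Complex.norm_natCast]
        refine div_le_one_of_le₀ (by exact_mod_cast Nat.sub_le m j) (by positivity)
      have h2 : ‖c j‖ ≤ 2 * T := norm_le_two_mul_of_abs_reTrigPoly_le (hj.trans_le hm) hT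
      have h3 : ‖(Circle.exp (-(j * β / n)) : ℂ) - 1‖ ≤ m * Real.pi / n := by
        refine (norm_circleExp_sub_one_le _).trans ?_
        rw [abs_neg, abs_div, abs_mul, Nat.abs_cast, Nat.abs_cast]
        gcongr
      calc _ ≤ 1 * (2 * T) * (m * Real.pi / n) := by gcongr
        _ = _ := by ring
    · rw [Finset.sum_const, Finset.card_range, nsmul_eq_mul]
      ring
  have hfin : ‖P‖ = ((Circle.exp (β - n * θ) : ℂ) * ∑ j ∈ Finset.range m, ((m - j : ℕ) / m : ℂ) *
        (c j * (Circle.exp θ : ℂ) ^ j) * (Circle.exp (-(j * β / n)) : ℂ)).re +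
      ((Circle.exp (β - n * θ) : ℂ) * (P - ∑ j ∈ Finset.range m, ((m - j : ℕ) / m : ℂ) *
        (c j * (Circle.exp θ : ℂ) ^ j) * (Circle.exp (-(j * β / n)) : ℂ))).re := by
    rw [← Complex.add_re, ← mul_add, add_sub_cancel, hβP, Complex.ofReal_re]
  rw [hfin, ← havg]
  refine add_le_add hle ((Complex.re_le_norm _).trans ?_)
  rw [norm_mul, Circle.norm_coe, one_mul]
  exact herr

/-- The Fejér mean has coefficients `(1 - j / m) c j`; the missing parts `(j / m) c j`, `j ≤ l`, are
small for large `m` and are added back. -/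
lemma exists_polynomial_of_abs_reTrigPoly_le (l : ℕ) {δ : ℝ} (hδ : 0 < δ) :
    ∃ n₀ : ℕ, ∀ n ≥ n₀, ∀ (c : ℕ → ℂ) (T : ℝ), (∀ t, |reTrigPoly n n c t| ≤ T) →
      ∃ G : Polynomial ℂ, (∀ j ≤ l, G.coeff j = c j) ∧
        ∀ t : ℝ, ‖G.eval (Circle.exp t : ℂ)‖ ≤ (1 + δ) * T := by
  obtain ⟨m, hm⟩ := exists_nat_gt (max (l : ℝ) (4 * (l + 1) ^ 2 / δ))
  obtain ⟨N, hN⟩ := exists_nat_gt (max (m : ℝ) (4 * m ^ 2 * Real.pi / δ))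
  have hlm : l < m := by exact_mod_cast (le_max_left _ _).trans_lt hm
  have hm0 : 0 < m := by omega
  have hmR : (0 : ℝ) < m := by exact_mod_cast hm0
  have hmC : (m : ℂ) ≠ 0 := by exact_mod_cast hm0.ne'
  refine ⟨N, fun n hn c T hT => ?_⟩
  have hnN : (N : ℝ) ≤ n := by exact_mod_cast hn
  have hmn : m < n := by exact_mod_cast ((le_max_left _ _).trans_lt hN).trans_le hnN
  have hnR : (0 : ℝ) < n := by exact_mod_cast hm0.trans hmn
  have hT0 : 0 ≤ T := (abs_nonneg _).trans (hT 0)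
  refine ⟨∑ j ∈ Finset.range m, Polynomial.monomial j (((m - j : ℕ) / m : ℂ) * c j) +
    ∑ j ∈ Finset.range (l + 1), Polynomial.monomial j ((j / m : ℂ) * c j), ?_, ?_⟩
  · intro j hj
    have h1 : j < m := by omega
    have h2 : j < l + 1 := by omega
    simp only [Polynomial.coeff_add, Polynomial.finsetSum_coeff, Polynomial.coeff_monomial,
      Finset.sum_ite_eq', Finset.mem_range, h1, h2, if_true]
    rw [← add_mul, ← add_div, Nat.cast_sub h1.le, sub_add_cancel, div_self hmC, one_mul]
  · intro t
    rw [Polynomial.eval_add, Polynomial.eval_finsetSum, Polynomial.eval_finsetSum]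
    simp only [Polynomial.eval_monomial, mul_assoc]
    refine (norm_add_le_of_le (norm_fejer_sum_le hm0 hmn.le hT t)
      (norm_sum_le_of_le _ (n := fun _ => (l + 1) / m * (2 * T)) fun j hj => ?_)).trans ?_
    · rw [Finset.mem_range] at hj
      rw [norm_mul, norm_mul, norm_pow, Circle.norm_coe, one_pow, mul_one, norm_div,
        Complex.norm_natCast, Complex.norm_natCast]
      have h2 : ‖c j‖ ≤ 2 * T := norm_le_two_mul_of_abs_reTrigPoly_le (by omega) hT
      have h3 : (j : ℝ) ≤ l + 1 := by exact_mod_cast hj.le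
      gcongr
    · rw [Finset.sum_const, Finset.card_range, nsmul_eq_mul]
      have h4 : 4 * (l + 1 : ℝ) ^ 2 / m ≤ δ := by
        rw [div_le_iff₀ hmR]
        have := (div_lt_iff₀ hδ).1 ((le_max_right _ _).trans_lt hm)
        linarith
      have h5 : 4 * (m : ℝ) ^ 2 * Real.pi / n ≤ δ := by
        rw [div_le_iff₀ hnR]
        have := (div_lt_iff₀ hδ).1 (((le_max_right _ _).trans_lt hN).trans_le hnN)
        linarith
      have h6 : T + 2 * T * m ^ 2 * Real.pi / n + ((l + 1 : ℕ) : ℝ) * ((l + 1) / m * (2 * T)) =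
          T + T / 2 * (4 * m ^ 2 * Real.pi / n) + T / 2 * (4 * (l + 1 : ℝ) ^ 2 / m) := by
        push_cast; ring
      rw [h6]
      have := mul_le_mul_of_nonneg_left h4 (by linarith : (0 : ℝ) ≤ T / 2)
      have := mul_le_mul_of_nonneg_left h5 (by linarith : (0 : ℝ) ≤ T / 2)
      linarith

lemma reTrigPoly_add {n m : ℕ} (hmn : m ≤ n) (c : ℕ → ℂ) (t s : ℝ) :
    reTrigPoly n m c (t + s) = reTrigPoly n m (fun j => c j * (Circle.exp s : ℂ) ^ (n - j)) t := by
  rw [reTrigPoly_eq hmn, reTrigPoly_eq hmn]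
  congr 1
  refine Finset.sum_congr rfl fun j _ => ?_
  rw [Circle.exp_add, Circle.coe_mul, mul_pow]
  ring

lemma abs_reTrigPoly_le_tauNorm (n : ℕ) (τ : ℕ → ℂ) (t : ℝ) :
    |reTrigPoly n n (fun j => conj (τ j)) t| ≤ tauNorm n τ :=
  abs_le_supNorm (continuous_reTrigPoly _ _ _) (reTrigPoly_periodic le_rfl _) t

/-- The estimate with a relative instead of an additive error. -/
lemma four_mul_productNorm_le_one_add_mul (l : ℕ) {δ : ℝ} (hδ : 0 < δ) :
    ∃ n₀ : ℕ, ∀ n ≥ n₀, ∀ μ τ : ℕ → ℂ,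
      4 * productNorm l n μ τ ≤ (1 + δ) * muNorm n μ * tauNorm n τ := by
  obtain ⟨n₀, h₀⟩ := exists_polynomial_of_abs_reTrigPoly_le l hδ
  refine ⟨max n₀ (2 * l + 1), fun n hn μ τ => ?_⟩
  have hn1 : n₀ ≤ n := (le_max_left _ _).trans hn
  have hn2 : 2 * l + 1 ≤ n := (le_max_right _ _).trans hn
  rw [← le_div_iff₀' four_pos]
  refine supNorm_le fun s => ?_
  rw [le_div_iff₀' four_pos]
  have hT : ∀ t, |reTrigPoly n n (fun j => conj (τ j) * (Circle.exp (-s) : ℂ) ^ (n - j)) t| ≤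
      tauNorm n τ := by
    intro t
    rw [← reTrigPoly_add le_rfl]
    exact abs_reTrigPoly_le_tauNorm n τ _
  obtain ⟨G, hGc, hG⟩ := h₀ n hn1 _ _ hT
  have h := four_mul_abs_re_sum_le (l := l) (n := n) (by omega) (by omega) μ G hG
  refine (le_of_eq ?_).trans (h.trans (le_of_eq ?_))
  · congr 2
    rw [reTrigPoly_eq (by omega), ← Complex.conj_re, map_sum]
    congr 1
    refine Finset.sum_congr rfl fun j hj => ?_
    rw [Finset.mem_range] at hj
    rw [hGc j (by omega), Circle.exp_neg, Circle.coe_inv, map_mul, map_mul, map_pow,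
      conj_circleExp]
    ring
  · rw [muNorm]; ring

lemma productNorm_le_of_norm_le {l n : ℕ} (hln : l < n) {M : ℝ} {μ τ : ℕ → ℂ}
    (hM : ∀ j ≤ l, ‖μ j‖ ≤ M) : productNorm l n μ τ ≤ (l + 1) * M * (2 * tauNorm n τ) := by
  have hM0 : 0 ≤ M := (norm_nonneg _).trans (hM 0 (Nat.zero_le _))
  refine supNorm_le fun s => ?_
  rw [reTrigPoly_eq hln.le]
  refine (Complex.abs_re_le_norm _).trans ((norm_sum_le_of_le _
    (n := fun _ => M * (2 * tauNorm n τ)) fun j hj => ?_).trans (le_of_eq ?_))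
  · rw [Finset.mem_range] at hj
    rw [norm_mul, norm_mul, norm_pow, Circle.norm_coe, one_pow, mul_one]
    have h2 := norm_le_two_mul_of_abs_reTrigPoly_le (j := j) (by omega)
      (abs_reTrigPoly_le_tauNorm n τ)
    rw [RCLike.norm_conj] at h2
    exact mul_le_mul (hM _ (by omega)) h2 (norm_nonneg _) hM0
  · rw [Finset.sum_const, Finset.card_range, nsmul_eq_mul]
    push_cast; ring

theorem four_mul_productNorm_le (l : ℕ) {ε : ℝ} (hε : 0 < ε) (M : ℝ) :
    ∃ n₀ : ℕ, l ≤ n₀ ∧ ∀ n : ℕ, n₀ ≤ n → ∀ μ τ : ℕ → ℂ, (∀ j : ℕ, j ≤ l → ‖μ j‖ ≤ M) →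
      4 * productNorm l n μ τ ≤ (muNorm n μ + ε) * tauNorm n τ := by
  set C : ℝ := 8 * (l + 1) * |M| + 1 with hC
  have hC0 : 0 < C := by positivity
  obtain ⟨n₀, h₀⟩ := four_mul_productNorm_le_one_add_mul l (div_pos hε hC0)
  refine ⟨max n₀ (l + 1), by omega, fun n hn μ τ hM => ?_⟩
  have hT0 : 0 ≤ tauNorm n τ := supNorm_nonneg _
  -- For `‖A‖₁ ≤ C` the relative error `ε / C` is at most `ε`; otherwise the crude bound suffices.
  rcases le_total (muNorm n μ) C with hA | hA
  · refine (h₀ n (by omega) μ τ).trans (mul_le_mul_of_nonneg_right ?_ hT0)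
    rw [add_mul, one_mul, div_mul_eq_mul_div]
    gcongr
    rw [div_le_iff₀ hC0]
    gcongr
  · have h1 := productNorm_le_of_norm_le (τ := τ) (show l < n by omega) hM
    have h2 : 8 * (l + 1) * M ≤ muNorm n μ + ε := by
      have := mul_le_mul_of_nonneg_left (le_abs_self M) (show (0 : ℝ) ≤ 8 * (l + 1) by positivity)
      linarith
    have := mul_le_mul_of_nonneg_right h2 hT0
    linarith

/-! ### Norming functionals on the unit circle -/

/-- Hahn–Banach for the distance to a subspace: a functional dominated by the seminorm that
vanishes on `U` and takes at `v` the distance from `v` to `U`. -/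
lemma Seminorm.exists_linearMap_eq_zero_on {V : Type*} [AddCommGroup V] [Module ℝ V]
    (p : Seminorm ℝ V) (U : Submodule ℝ V) (v : V) :
    ∃ Λ : V →ₗ[ℝ] ℝ, (∀ x, Λ x ≤ p x) ∧ (∀ u ∈ U, Λ u = 0) ∧
      ∀ η > 0, ∃ u ∈ U, p (v + u) < Λ v + η := by
  -- `q` is the quotient seminorm.
  set q : V → ℝ := fun x => ⨅ u : U, p (x + u) with hq
  have hbdd : ∀ x, BddBelow (Set.range fun u : U => p (x + u)) := fun x =>
    ⟨0, by rintro _ ⟨u, rfl⟩; exact apply_nonneg p _⟩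
  have hq0 : ∀ x, 0 ≤ q x := fun x => Real.iInf_nonneg fun u => apply_nonneg p _
  have hqle : ∀ x, ∀ u ∈ U, q x ≤ p (x + u) := fun x u hu => ciInf_le (hbdd x) ⟨u, hu⟩
  have hqlt : ∀ x, ∀ η > 0, ∃ u ∈ U, p (x + u) < q x + η := by
    intro x η hη
    obtain ⟨u, hu⟩ := exists_lt_of_ciInf_lt (lt_add_of_pos_right (q x) hη)
    exact ⟨u, u.2, hu⟩
  have hqp : ∀ x, q x ≤ p x := fun x => by simpa using hqle x 0 U.zero_mem
  have hqU : ∀ u ∈ U, q u = 0 := fun u hu =>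
    le_antisymm (by simpa using hqle u (-u) (U.neg_mem hu)) (hq0 u)
  have hadd : ∀ x y, q (x + y) ≤ q x + q y := by
    intro x y
    refine le_of_forall_pos_le_add fun η hη => ?_
    obtain ⟨u, hu, hxu⟩ := hqlt x (η / 2) (half_pos hη)
    obtain ⟨w, hw, hyw⟩ := hqlt y (η / 2) (half_pos hη)
    have h1 := hqle (x + y) (u + w) (U.add_mem hu hw)
    have h2 := map_add_le_add p (x + u) (y + w)
    rw [add_add_add_comm] at h1
    linarith
  have hle : ∀ c : ℝ, 0 < c → ∀ x, q (c • x) ≤ c * q x := by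
    intro c hc x
    refine le_of_forall_pos_le_add fun η hη => ?_
    obtain ⟨u, hu, hxu⟩ := hqlt x (η / c) (div_pos hη hc)
    have h1 := hqle (c • x) (c • u) (U.smul_mem c hu)
    rw [← smul_add, map_smul_eq_mul, Real.norm_eq_abs, abs_of_pos hc] at h1
    have h2 := mul_lt_mul_of_pos_left hxu hc
    rw [mul_add, mul_div_cancel₀ _ hc.ne'] at h2
    linarith
  have hhom : ∀ c : ℝ, 0 < c → ∀ x, q (c • x) = c * q x := by
    intro c hc x
    refine le_antisymm (hle c hc x) ?_
    have := hle c⁻¹ (inv_pos.2 hc) (c • x)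
    rwa [inv_smul_smul₀ hc.ne', le_inv_mul_iff₀ hc] at this
  obtain ⟨Λ, hΛv, hΛ⟩ : ∃ Λ : V →ₗ[ℝ] ℝ, Λ v = q v ∧ ∀ x, Λ x ≤ q x := by
    rcases eq_or_ne v 0 with rfl | hv
    · exact ⟨0, by simp [hqU 0 U.zero_mem], fun x => by simpa using hq0 x⟩
    · obtain ⟨Λ, h1, h2⟩ := exists_extension_of_le_sublinear
        (LinearPMap.mkSpanSingleton v (q v) hv) q hhom hadd (by
          rintro ⟨x, hx⟩
          obtain ⟨c, rfl⟩ := Submodule.mem_span_singleton.1 hx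
          rw [LinearPMap.mkSpanSingleton'_apply, RingHom.id_apply, smul_eq_mul]
          rcases lt_or_ge 0 c with hc | hc
          · exact (hhom c hc v).ge
          · exact (mul_nonpos_of_nonpos_of_nonneg hc (hq0 v)).trans (hq0 _))
      refine ⟨Λ, ?_, h2⟩
      have h3 := h1 ⟨v, Submodule.mem_span_singleton_self v⟩
      rw [h3]
      exact LinearPMap.mkSpanSingleton_apply ℝ ℝ hv (q v)
  refine ⟨Λ, fun x => (hΛ x).trans (hqp x), fun u hu => le_antisymm ?_ ?_, ?_⟩
  · exact (hΛ u).trans (hqU u hu).le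
  · have := (hΛ (-u)).trans (hqU (-u) (U.neg_mem hu)).le
    rw [map_neg] at this
    linarith
  · rw [hΛv]; exact hqlt v

/-- Real polynomials as continuous functions on the unit circle. -/
noncomputable def polyOnCircle : Polynomial ℝ →ₐ[ℝ] C(Circle, ℂ) :=
  Polynomial.aeval (⟨fun z => (z : ℂ), continuous_subtype_val⟩ : C(Circle, ℂ))

lemma polyOnCircle_apply (f : Polynomial ℝ) (z : Circle) :
    polyOnCircle f z = Polynomial.aeval (z : ℂ) f :=
  (Polynomial.aeval_algHom_apply (ContinuousMap.evalAlgHom ℝ ℂ z) _ f).symm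

/-- The characters `z ↦ z ^ k`, `k : ℤ`, of the unit circle. -/
noncomputable def circleChar (k : ℤ) : C(Circle, ℂ) :=
  ⟨fun z => ((z ^ k : Circle) : ℂ), continuous_subtype_val.comp (continuous_zpow k)⟩

lemma polyOnCircle_X_pow (k : ℕ) : polyOnCircle (Polynomial.X ^ k) = circleChar k := by
  ext z
  rw [polyOnCircle_apply]
  simp [circleChar]

/-- The normalized `L¹` seminorm on the unit circle. -/
noncomputable def circleL1Seminorm : Seminorm ℝ C(Circle, ℂ) :=
  Seminorm.of (fun f => (2 * Real.pi)⁻¹ * ∫ t in (0 : ℝ)..(2 * Real.pi), ‖f (Circle.exp t)‖)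
    (by
      intro f g
      rw [← mul_add, ← intervalIntegral.integral_add]
      · refine mul_le_mul_of_nonneg_left ?_ (by positivity)
        refine intervalIntegral.integral_mono_on Real.two_pi_pos.le ?_ ?_ ?_
        · exact Continuous.intervalIntegrable (by fun_prop) _ _
        · exact Continuous.intervalIntegrable (by fun_prop) _ _
        · intro t _
          exact norm_add_le _ _
      · exact Continuous.intervalIntegrable (by fun_prop) _ _
      · exact Continuous.intervalIntegrable (by fun_prop) _ _)
    (by
      intro c f
      simp only [ContinuousMap.smul_apply, norm_smul, intervalIntegral.integral_const_mul]
      ring)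

lemma circleL1Seminorm_apply (f : C(Circle, ℂ)) : circleL1Seminorm f =
    (2 * Real.pi)⁻¹ * ∫ t in (0 : ℝ)..(2 * Real.pi), ‖f (Circle.exp t)‖ := rfl

lemma circleL1Seminorm_le_norm (f : C(Circle, ℂ)) : circleL1Seminorm f ≤ ‖f‖ := by
  rw [circleL1Seminorm_apply, inv_mul_le_iff₀ Real.two_pi_pos]
  have := intervalIntegral.integral_mono_on (μ := MeasureTheory.volume) Real.two_pi_pos.le
    (Continuous.intervalIntegrable (u := fun t => ‖f (Circle.exp t)‖) (by fun_prop) _ _)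
    (continuous_const.intervalIntegrable _ _) fun t _ => f.norm_coe_le_norm (Circle.exp t)
  simpa using this

lemma abs_coeff_le_circleL1Seminorm (f : Polynomial ℝ) (j : ℕ) :
    |f.coeff j| ≤ circleL1Seminorm (polyOnCircle f) := by
  have h : ∫ t in (0 : ℝ)..(2 * Real.pi),
      polyOnCircle f (Circle.exp t) * (Circle.exp t : ℂ) ^ (-(j : ℤ)) =
      2 * Real.pi * f.coeff j := by
    have expand : ∀ t : ℝ, polyOnCircle f (Circle.exp t) * (Circle.exp t : ℂ) ^ (-(j : ℤ)) =
        ∑ k ∈ Finset.range (f.natDegree + 1),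
          (f.coeff k : ℂ) * (Circle.exp t : ℂ) ^ ((k : ℤ) - j) := by
      intro t
      rw [polyOnCircle_apply, Polynomial.aeval_eq_sum_range, Finset.sum_mul]
      refine Finset.sum_congr rfl fun k _ => ?_
      rw [sub_eq_add_neg, zpow_add₀ (Circle.coe_ne_zero _), zpow_natCast, Complex.real_smul,
        mul_assoc]
    simp_rw [expand]
    rw [intervalIntegral.integral_finsetSum]
    · simp_rw [intervalIntegral.integral_const_mul, integral_circleExp_zpow, sub_eq_zero,
        Nat.cast_inj, mul_ite, mul_zero]
      rw [Finset.sum_ite_eq']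
      split_ifs with hj
      · ring
      · rw [Polynomial.coeff_eq_zero_of_natDegree_lt (by rw [Finset.mem_range] at hj; omega)]
        simp
    · intro k _
      exact (continuous_const.mul (continuous_circleExp_zpow _)).intervalIntegrable _ _
  rw [circleL1Seminorm_apply, le_inv_mul_iff₀ Real.two_pi_pos]
  have h2 := intervalIntegral.norm_integral_le_integral_norm (μ := MeasureTheory.volume)
    (f := fun t => polyOnCircle f (Circle.exp t) * (Circle.exp t : ℂ) ^ (-(j : ℤ)))
    Real.two_pi_pos.le
  rw [h] at h2
  simpa [abs_of_pos Real.pi_pos] using h2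

/-- Real polynomials divisible by `X ^ (l + 1)`, as functions on the circle. -/
noncomputable def highOrderSubspace (l : ℕ) : Submodule ℝ C(Circle, ℂ) :=
  ((Ideal.span {(Polynomial.X : Polynomial ℝ) ^ (l + 1)}).restrictScalars ℝ).map
    polyOnCircle.toLinearMap

lemma mem_highOrderSubspace {l : ℕ} {u : C(Circle, ℂ)} :
    u ∈ highOrderSubspace l ↔ ∃ h : Polynomial ℝ, (∀ j ≤ l, h.coeff j = 0) ∧
      polyOnCircle h = u := by
  simp only [highOrderSubspace, Submodule.mem_map, Submodule.restrictScalars_mem,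
    Ideal.mem_span_singleton, Polynomial.X_pow_dvd_iff, Nat.lt_succ_iff, AlgHom.toLinearMap_apply]

/-- The polynomial with coefficients `a 0, …, a l`; the values `a j` with `l < j` play no role. -/
noncomputable def prefixPoly (l : ℕ) (a : ℕ → ℝ) : Polynomial ℝ :=
  ∑ j ∈ Finset.range (l + 1), Polynomial.monomial j (a j)

lemma coeff_prefixPoly {l j : ℕ} (hj : j ≤ l) (a : ℕ → ℝ) : (prefixPoly l a).coeff j = a j := by
  have : j < l + 1 := by omega
  simp [prefixPoly, Polynomial.finsetSum_coeff, Polynomial.coeff_monomial, this]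

/-- The coefficient of order `l` of the product of the power series with coefficients `a`, `b`. -/
def cauchyCoeff (l : ℕ) (a b : ℕ → ℝ) : ℝ := ∑ j ∈ Finset.range (l + 1), a (l - j) * b j

lemma cauchyCoeff_comm (l : ℕ) (a b : ℕ → ℝ) : cauchyCoeff l a b = cauchyCoeff l b a := by
  rw [cauchyCoeff, ← Finset.sum_range_reflect, cauchyCoeff]
  refine Finset.sum_congr rfl fun j hj => ?_
  rw [Finset.mem_range] at hj
  rw [mul_comm, show l + 1 - 1 - j = l - j by omega, show l - (l - j) = j by omega]

lemma map_polyOnCircle_eq_cauchyCoeff {l : ℕ} {Λ : C(Circle, ℂ) →ₗ[ℝ] ℝ}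
    (hΛ : ∀ u ∈ highOrderSubspace l, Λ u = 0) {f : Polynomial ℝ} {a : ℕ → ℝ}
    (hf : ∀ j ≤ l, f.coeff j = a j) :
    Λ (polyOnCircle f) = cauchyCoeff l (fun j => Λ (circleChar ((l : ℤ) - j))) a := by
  have h1 : Λ (polyOnCircle (f - prefixPoly l a)) = 0 :=
    hΛ _ (mem_highOrderSubspace.2 ⟨_, fun j hj => by
      rw [Polynomial.coeff_sub, hf j hj, coeff_prefixPoly hj, sub_self], rfl⟩)
  rw [map_sub, map_sub, sub_eq_zero] at h1
  rw [h1, prefixPoly, map_sum, map_sum, cauchyCoeff]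
  refine Finset.sum_congr rfl fun j hj => ?_
  rw [Finset.mem_range] at hj
  rw [← mul_one (a j), ← smul_eq_mul, ← Polynomial.smul_monomial, map_smul, map_smul,
    Polynomial.monomial_one_right_eq_X_pow, polyOnCircle_X_pow, smul_eq_mul, smul_eq_mul,
    mul_one, mul_comm]
  congr 3
  omega

/-- A norming functional for the smallest seminorm among the polynomials with prescribed first
coefficients. -/
lemma exists_norming_functional (l : ℕ) (p : Seminorm ℝ C(Circle, ℂ))
    (hp : ∀ (f : Polynomial ℝ) (j : ℕ), |f.coeff j| ≤ p (polyOnCircle f))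
    {a : ℕ → ℝ} (ha : ∃ j ≤ l, a j ≠ 0) :
    ∃ Λ : C(Circle, ℂ) →ₗ[ℝ] ℝ, (∀ x, Λ x ≤ p x) ∧ (∀ u ∈ highOrderSubspace l, Λ u = 0) ∧
      0 < cauchyCoeff l (fun j => Λ (circleChar ((l : ℤ) - j))) a ∧
      ∀ η > 0, ∃ f : Polynomial ℝ, (∀ j ≤ l, f.coeff j = a j) ∧
        p (polyOnCircle f) < cauchyCoeff l (fun j => Λ (circleChar ((l : ℤ) - j))) a + η := by
  obtain ⟨Λ, h1, h2, h3⟩ :=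
    p.exists_linearMap_eq_zero_on (highOrderSubspace l) (polyOnCircle (prefixPoly l a))
  rw [map_polyOnCircle_eq_cauchyCoeff h2 fun j hj => coeff_prefixPoly hj a] at h3
  have h4 : ∀ η > 0, ∃ f : Polynomial ℝ, (∀ j ≤ l, f.coeff j = a j) ∧
        p (polyOnCircle f) < cauchyCoeff l (fun j => Λ (circleChar ((l : ℤ) - j))) a + η := by
    intro η hη
    obtain ⟨u, hu, hlt⟩ := h3 η hη
    obtain ⟨h, hh, rfl⟩ := mem_highOrderSubspace.1 hu
    refine ⟨prefixPoly l a + h, fun j hj => ?_, by rwa [map_add]⟩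
    rw [Polynomial.coeff_add, coeff_prefixPoly hj, hh j hj, add_zero]
  refine ⟨Λ, h1, h2, ?_, h4⟩
  obtain ⟨j, hj, haj⟩ := ha
  refine lt_of_lt_of_le (abs_pos.2 haj) (le_of_forall_pos_le_add fun η hη => ?_)
  obtain ⟨f, hf, hlt⟩ := h4 η hη
  rw [← hf j hj]
  exact (hp f j).trans hlt.le

/-! ### Fejér means and extremal pairs -/

lemma integral_norm_sq_geom_sum (m : ℕ) (s : ℝ) :
    ∫ t in (0 : ℝ)..(2 * Real.pi), ‖∑ a ∈ Finset.range m, (Circle.exp (t + s) : ℂ) ^ a‖ ^ 2 =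
      2 * Real.pi * m := by
  have expand : ∀ t : ℝ,
      ((‖∑ a ∈ Finset.range m, (Circle.exp (t + s) : ℂ) ^ a‖ ^ 2 : ℝ) : ℂ) =
      ∑ b ∈ Finset.range m, ∑ a ∈ Finset.range m,
        (Circle.exp s : ℂ) ^ ((a : ℤ) - b) * (Circle.exp t : ℂ) ^ ((a : ℤ) - b) := by
    intro t
    rw [Complex.ofReal_pow, ← Complex.conj_mul', map_sum, Finset.sum_mul_sum]
    refine Finset.sum_congr rfl fun b _ => Finset.sum_congr rfl fun a _ => ?_
    rw [map_pow, conj_circleExp, ← mul_zpow, mul_comm (Circle.exp s : ℂ), ← Circle.coe_mul,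
      ← Circle.exp_add, zpow_sub₀ (Circle.coe_ne_zero _), zpow_natCast, zpow_natCast, inv_pow]
    ring
  have hc : ∀ a b : ℕ, IntervalIntegrable (fun t : ℝ =>
      (Circle.exp s : ℂ) ^ ((a : ℤ) - b) * (Circle.exp t : ℂ) ^ ((a : ℤ) - b))
      MeasureTheory.volume 0 (2 * Real.pi) := fun a b =>
    (continuous_const.mul (continuous_circleExp_zpow _)).intervalIntegrable _ _
  rw [← Complex.ofReal_inj, ← intervalIntegral.integral_ofReal]
  simp_rw [expand]
  rw [intervalIntegral.integral_finsetSum]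
  · have : ∀ b ∈ Finset.range m, ∫ t in (0 : ℝ)..(2 * Real.pi), ∑ a ∈ Finset.range m,
        (Circle.exp s : ℂ) ^ ((a : ℤ) - b) * (Circle.exp t : ℂ) ^ ((a : ℤ) - b) =
        2 * Real.pi := by
      intro b hb
      rw [intervalIntegral.integral_finsetSum fun a _ => hc a b]
      simp_rw [intervalIntegral.integral_const_mul, integral_circleExp_zpow, sub_eq_zero,
        Nat.cast_inj, mul_ite, mul_zero]
      rw [Finset.sum_ite_eq', if_pos hb, sub_self, zpow_zero, one_mul]
    rw [Finset.sum_congr rfl this]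
    simp
    ring
  · intro b _
    have := IntervalIntegrable.sum (Finset.range m) fun a _ => hc a b
    simpa only [Finset.sum_fn] using this

/-- The part of a translated and rotated Fejér kernel with real Fourier coefficients has normalized
`L¹` seminorm at most one. -/
lemma circleL1Seminorm_fejer_le {m : ℕ} (hm : 0 < m) (γ : Circle) (θ : ℝ) :
    circleL1Seminorm (∑ a ∈ Finset.range m, ∑ b ∈ Finset.range m,
      ((m : ℝ)⁻¹ * ((γ : ℂ) * (Circle.exp θ : ℂ) ^ ((b : ℤ) - a)).re) •
        circleChar ((a : ℤ) - b)) ≤ 1 := by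
  have hmR : (m : ℝ) ≠ 0 := by exact_mod_cast hm.ne'
  have hsq : ∀ s : ℝ, ∑ a ∈ Finset.range m, ∑ b ∈ Finset.range m,
      (Circle.exp s : ℂ) ^ ((a : ℤ) - b) =
      ((‖∑ a ∈ Finset.range m, (Circle.exp s : ℂ) ^ a‖ ^ 2 : ℝ) : ℂ) := by
    intro s
    rw [Complex.ofReal_pow, ← Complex.mul_conj', map_sum, Finset.sum_mul_sum]
    refine Finset.sum_congr rfl fun a _ => Finset.sum_congr rfl fun b _ => ?_
    rw [map_pow, conj_circleExp, zpow_sub₀ (Circle.coe_ne_zero _), zpow_natCast, zpow_natCast,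
      inv_pow, div_eq_mul_inv]
  have hval : ∀ t : ℝ, (∑ a ∈ Finset.range m, ∑ b ∈ Finset.range m,
      ((m : ℝ)⁻¹ * ((γ : ℂ) * (Circle.exp θ : ℂ) ^ ((b : ℤ) - a)).re) •
        circleChar ((a : ℤ) - b)) (Circle.exp t) =
      (2 * m : ℂ)⁻¹ * (γ * ∑ a ∈ Finset.range m, ∑ b ∈ Finset.range m,
          (Circle.exp (t + -θ) : ℂ) ^ ((a : ℤ) - b) +
        conj (γ : ℂ) * ∑ a ∈ Finset.range m, ∑ b ∈ Finset.range m,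
          (Circle.exp (t + θ) : ℂ) ^ ((a : ℤ) - b)) := by
    intro t
    simp only [ContinuousMap.coe_sum, Finset.sum_apply, ContinuousMap.smul_apply, Finset.mul_sum,
      ← Finset.sum_add_distrib]
    refine Finset.sum_congr rfl fun a _ => Finset.sum_congr rfl fun b _ => ?_
    rw [Complex.real_smul, Complex.ofReal_mul, Complex.re_eq_add_conj, map_mul, map_zpow₀,
      conj_circleExp, Circle.exp_add, Circle.exp_add, Circle.exp_neg, Circle.coe_mul,
      Circle.coe_mul, Circle.coe_inv, mul_zpow, mul_zpow, inv_zpow', inv_zpow', neg_sub, neg_sub]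
    simp only [circleChar, ContinuousMap.coe_mk, Circle.coe_zpow]
    push_cast
    field_simp
  have hle : ∀ t : ℝ, ‖(∑ a ∈ Finset.range m, ∑ b ∈ Finset.range m,
      ((m : ℝ)⁻¹ * ((γ : ℂ) * (Circle.exp θ : ℂ) ^ ((b : ℤ) - a)).re) •
        circleChar ((a : ℤ) - b)) (Circle.exp t)‖ ≤
      (2 * m : ℝ)⁻¹ * (‖∑ a ∈ Finset.range m, (Circle.exp (t + -θ) : ℂ) ^ a‖ ^ 2 +
        ‖∑ a ∈ Finset.range m, (Circle.exp (t + θ) : ℂ) ^ a‖ ^ 2) := by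
    intro t
    rw [hval, hsq, hsq, norm_mul]
    refine mul_le_mul (le_of_eq (by simp)) ((norm_add_le _ _).trans (le_of_eq ?_))
      (norm_nonneg _) (by positivity)
    rw [norm_mul, norm_mul, RCLike.norm_conj, Circle.norm_coe, one_mul, one_mul,
      Complex.norm_real, Complex.norm_real, Real.norm_of_nonneg (sq_nonneg _),
      Real.norm_of_nonneg (sq_nonneg _)]
  have hcont : ∀ s : ℝ, Continuous fun t : ℝ =>
      ‖∑ a ∈ Finset.range m, (Circle.exp (t + s) : ℂ) ^ a‖ ^ 2 := fun s =>
    (continuous_finsetSum _ fun a _ =>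
      (continuous_circleExp_coe.comp (continuous_id.add continuous_const)).pow a).norm.pow 2
  have hcont' : Continuous fun t : ℝ => (2 * m : ℝ)⁻¹ *
      (‖∑ a ∈ Finset.range m, (Circle.exp (t + -θ) : ℂ) ^ a‖ ^ 2 +
        ‖∑ a ∈ Finset.range m, (Circle.exp (t + θ) : ℂ) ^ a‖ ^ 2) :=
    continuous_const.mul ((hcont (-θ)).add (hcont θ))
  rw [circleL1Seminorm_apply, inv_mul_le_iff₀ Real.two_pi_pos, mul_one]
  refine (intervalIntegral.integral_mono_on (μ := MeasureTheory.volume) Real.two_pi_pos.le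
    (Continuous.intervalIntegrable (by fun_prop) _ _)
    (hcont'.intervalIntegrable _ _)
    fun t _ => hle t).trans (le_of_eq ?_)
  rw [intervalIntegral.integral_const_mul, intervalIntegral.integral_add
    ((hcont _).intervalIntegrable _ _) ((hcont _).intervalIntegrable _ _),
    integral_norm_sq_geom_sum, integral_norm_sq_geom_sum]
  field_simp
  ring

/-- The Fejér means of the power series whose coefficients represent a functional of norm one
in `L¹` are bounded by one. -/
lemma exists_fejer_mean (l : ℕ) {Λ : C(Circle, ℂ) →ₗ[ℝ] ℝ} (hΛ : ∀ x, Λ x ≤ circleL1Seminorm x)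
    (hU : ∀ u ∈ highOrderSubspace l, Λ u = 0) {m : ℕ} (hm : 0 < m) :
    ∃ g : Polynomial ℝ,
      (∀ j ≤ l, g.coeff j = ((m - (l - j) : ℕ) / m : ℝ) * Λ (circleChar ((l : ℤ) - j))) ∧
      ∀ z : Circle, ‖polyOnCircle g z‖ ≤ 1 := by
  have hmR : (m : ℝ) ≠ 0 := by exact_mod_cast hm.ne'
  have hchar : ∀ a b : ℕ, ¬ a ≤ l + b → Λ (circleChar ((a : ℤ) - b)) = 0 := by
    intro a b hab
    refine hU _ (mem_highOrderSubspace.2 ⟨Polynomial.X ^ (a - b), fun j hj => ?_, ?_⟩)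
    · rw [Polynomial.coeff_X_pow, if_neg (by omega)]
    · rw [polyOnCircle_X_pow]
      congr 1
      omega
  refine ⟨∑ b ∈ Finset.range m, ∑ a ∈ Finset.range m, if a ≤ l + b then
    Polynomial.monomial (l + b - a) ((m : ℝ)⁻¹ * Λ (circleChar ((a : ℤ) - b))) else 0, ?_, ?_⟩
  · intro j hj
    simp only [Polynomial.finsetSum_coeff]
    have h1 : ∀ b ∈ Finset.range m, (∑ a ∈ Finset.range m, (if a ≤ l + b then
        Polynomial.monomial (l + b - a) ((m : ℝ)⁻¹ * Λ (circleChar ((a : ℤ) - b)))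
          else 0).coeff j) =
        if b < m - (l - j) then (m : ℝ)⁻¹ * Λ (circleChar ((l : ℤ) - j)) else 0 := by
      intro b _
      have h2 : ∀ a ∈ Finset.range m, (if a ≤ l + b then
          Polynomial.monomial (l + b - a) ((m : ℝ)⁻¹ * Λ (circleChar ((a : ℤ) - b)))
            else 0).coeff j =
          if a = b + (l - j) then (m : ℝ)⁻¹ * Λ (circleChar ((l : ℤ) - j)) else 0 := by
        intro a _
        by_cases ha : a ≤ l + b
        · rw [if_pos ha, Polynomial.coeff_monomial]
          by_cases h : a = b + (l - j)
          · rw [if_pos h, if_pos (by omega)]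
            congr 3
            omega
          · rw [if_neg h, if_neg (by omega)]
        · rw [if_neg ha, if_neg (by omega), Polynomial.coeff_zero]
      rw [Finset.sum_congr rfl h2, Finset.sum_ite_eq']
      refine if_congr ?_ rfl rfl
      rw [Finset.mem_range]
      omega
    rw [Finset.sum_congr rfl h1, ← Finset.sum_filter, Finset.sum_const,
      show (Finset.range m).filter (· < m - (l - j)) = Finset.range (m - (l - j)) by
        ext b; simp only [Finset.mem_filter, Finset.mem_range]; omega,
      Finset.card_range, nsmul_eq_mul]
    ring
  · intro z
    obtain ⟨θ, rfl⟩ := Circle.exp_surjective z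
    set g : Polynomial ℝ := ∑ b ∈ Finset.range m, ∑ a ∈ Finset.range m, if a ≤ l + b then
      Polynomial.monomial (l + b - a) ((m : ℝ)⁻¹ * Λ (circleChar ((a : ℤ) - b))) else 0 with hg
    have hval : polyOnCircle g (Circle.exp θ) = ∑ a ∈ Finset.range m, ∑ b ∈ Finset.range m,
        (((m : ℝ)⁻¹ * Λ (circleChar ((a : ℤ) - b)) : ℝ) : ℂ) *
          ((Circle.exp θ : ℂ) ^ l * (Circle.exp θ : ℂ) ^ ((b : ℤ) - a)) := by
      rw [polyOnCircle_apply, hg, map_sum, Finset.sum_comm]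
      refine Finset.sum_congr rfl fun b _ => ?_
      rw [map_sum]
      refine Finset.sum_congr rfl fun a _ => ?_
      split_ifs with hab
      · rw [Polynomial.aeval_monomial, ← zpow_natCast, ← zpow_natCast,
          ← zpow_add₀ (Circle.coe_ne_zero _)]
        congr 2
        omega
      · rw [hchar a b hab]
        simp
    -- Rotating by the phase of `g` reduces the bound to a real part, to which `Λ` applies.
    set c : Circle := Circle.exp (-(polyOnCircle g (Circle.exp θ)).arg) with hc
    have hrot : ‖polyOnCircle g (Circle.exp θ)‖ =
        ((c : ℂ) * polyOnCircle g (Circle.exp θ)).re := by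
      have h1 := Complex.norm_mul_exp_arg_mul_I (polyOnCircle g (Circle.exp θ))
      rw [← Circle.coe_exp] at h1
      have h2 : (c : ℂ) * polyOnCircle g (Circle.exp θ) = ‖polyOnCircle g (Circle.exp θ)‖ := by
        rw [hc, Circle.exp_neg, Circle.coe_inv, inv_mul_eq_iff_eq_mul₀ (Circle.coe_ne_zero _),
          mul_comm, h1]
      rw [h2, Complex.ofReal_re]
    have hΛval : ((c : ℂ) * polyOnCircle g (Circle.exp θ)).re =
        Λ (∑ a ∈ Finset.range m, ∑ b ∈ Finset.range m,
          ((m : ℝ)⁻¹ * (((c * Circle.exp θ ^ l : Circle) : ℂ) *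
            (Circle.exp θ : ℂ) ^ ((b : ℤ) - a)).re) • circleChar ((a : ℤ) - b)) := by
      simp only [hval, map_sum, map_smul, Finset.mul_sum, Complex.re_sum]
      refine Finset.sum_congr rfl fun a _ => Finset.sum_congr rfl fun b _ => ?_
      rw [mul_left_comm, Complex.re_ofReal_mul, Circle.coe_mul, Circle.coe_pow, smul_eq_mul,
        ← mul_assoc (c : ℂ)]
      ring
    rw [hrot, hΛval]
    exact (hΛ _).trans (circleL1Seminorm_fejer_le hm _ θ)

/-- Fejér means of high order, with the exact initial coefficients restored. -/
lemma exists_polynomial_norm_le_one_add (l : ℕ) {Λ : C(Circle, ℂ) →ₗ[ℝ] ℝ}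
    (hΛ : ∀ x, Λ x ≤ circleL1Seminorm x) (hU : ∀ u ∈ highOrderSubspace l, Λ u = 0) {η : ℝ}
    (hη : 0 < η) :
    ∃ g : Polynomial ℝ, (∀ j ≤ l, g.coeff j = Λ (circleChar ((l : ℤ) - j))) ∧
      ∀ z : Circle, ‖polyOnCircle g z‖ ≤ 1 + η := by
  set B : ℝ := ∑ j ∈ Finset.range (l + 1), l * |Λ (circleChar ((l : ℤ) - j))| with hB
  obtain ⟨m, hm⟩ := exists_nat_gt (max (l : ℝ) (B / η))
  have hlm : l < m := by exact_mod_cast (le_max_left _ _).trans_lt hm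
  have hmR : (0 : ℝ) < m := by exact_mod_cast (Nat.zero_le l).trans_lt hlm
  obtain ⟨g, hg1, hg2⟩ := exists_fejer_mean l hΛ hU (show 0 < m by omega)
  refine ⟨g + prefixPoly l (fun j => ((l - j : ℕ) / m : ℝ) * Λ (circleChar ((l : ℤ) - j))), ?_, ?_⟩
  · intro j hj
    rw [Polynomial.coeff_add, hg1 j hj, coeff_prefixPoly hj, ← add_mul, ← add_div,
      Nat.cast_sub (show l - j ≤ m by omega), sub_add_cancel, div_self hmR.ne', one_mul]
  · intro z
    rw [map_add, ContinuousMap.add_apply]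
    refine norm_add_le_of_le (hg2 z) ?_
    rw [polyOnCircle_apply, prefixPoly, map_sum]
    refine le_trans (norm_sum_le_of_le _
      (n := fun j : ℕ => (l * |Λ (circleChar ((l : ℤ) - j))|) / m) fun j hj => ?_) ?_
    · rw [Polynomial.aeval_monomial, norm_mul, norm_pow, Circle.norm_coe, one_pow, mul_one,
        norm_algebraMap', norm_mul, Real.norm_eq_abs, Real.norm_eq_abs, abs_div, Nat.abs_cast,
        Nat.abs_cast, div_mul_eq_mul_div]
      gcongr
      omega
    · rw [← Finset.sum_div, div_le_iff₀ hmR]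
      have := (div_lt_iff₀ hη).1 ((le_max_right _ _).trans_lt hm)
      linarith

/-- Real coefficient vectors `a` and `b` for which the duality inequality between the minimal
`L¹` norm of power series starting with `a` and the minimal supremum norm of power series starting
with `b` is an equality; near-minimizers are required to be polynomials. -/
def IsExtremalPair (l : ℕ) (a b : ℕ → ℝ) : Prop :=
  0 < cauchyCoeff l a b ∧ ∀ η > 0, ∃ (f g : Polynomial ℝ) (S : ℝ),
    (∀ j ≤ l, f.coeff j = a j) ∧ (∀ j ≤ l, g.coeff j = b j) ∧
    (∀ z : Circle, ‖polyOnCircle g z‖ ≤ S) ∧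
    circleL1Seminorm (polyOnCircle f) * S ≤ cauchyCoeff l a b + η

lemma exists_pos_add_mul_add_le (d e : ℝ) {η : ℝ} (hη : 0 < η) :
    ∃ ζ > 0, (d + ζ) * (e + ζ) ≤ d * e + η := by
  have h : Filter.Tendsto (fun ζ : ℝ => (d + ζ) * (e + ζ)) (𝓝[>] 0) (𝓝 (d * e)) := by
    have : Continuous fun ζ : ℝ => (d + ζ) * (e + ζ) := by fun_prop
    simpa using (this.tendsto 0).mono_left nhdsWithin_le_nhds
  obtain ⟨ζ, h1, h2⟩ := ((h.eventually (gt_mem_nhds (lt_add_of_pos_right _ hη))).and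
    self_mem_nhdsWithin).exists
  exact ⟨ζ, h2, h1.le⟩

/-- For the given `a`, a sequence `b` whose pairing with `a` is the minimal `L¹` norm for `a`, while
the minimal supremum norm for `b` is at most one. -/
lemma exists_norming_sequence (l : ℕ) {a : ℕ → ℝ} (ha : ∃ j ≤ l, a j ≠ 0) :
    ∃ b : ℕ → ℝ, 0 < cauchyCoeff l a b ∧
      (∀ η > 0, ∃ f : Polynomial ℝ, (∀ j ≤ l, f.coeff j = a j) ∧
        circleL1Seminorm (polyOnCircle f) ≤ cauchyCoeff l a b + η) ∧
      ∀ η > 0, ∃ g : Polynomial ℝ, (∀ j ≤ l, g.coeff j = b j) ∧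
        ∀ z : Circle, ‖polyOnCircle g z‖ ≤ 1 + η := by
  obtain ⟨Λ, h1, h2, h3, h4⟩ :=
    exists_norming_functional l circleL1Seminorm abs_coeff_le_circleL1Seminorm ha
  rw [cauchyCoeff_comm] at h3 h4
  exact ⟨_, h3, fun η hη => (h4 η hη).imp fun f hf => ⟨hf.1, hf.2.le⟩,
    fun η hη => exists_polynomial_norm_le_one_add l h1 h2 hη⟩

lemma exists_isExtremalPair_right (l : ℕ) {a : ℕ → ℝ} (ha : ∃ j ≤ l, a j ≠ 0) :
    ∃ b, IsExtremalPair l a b := by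
  obtain ⟨b, h1, h2, h3⟩ := exists_norming_sequence l ha
  refine ⟨b, h1, fun η hη => ?_⟩
  obtain ⟨ζ, hζ, hle⟩ := exists_pos_add_mul_add_le (cauchyCoeff l a b) 1 hη
  obtain ⟨f, hf, hfn⟩ := h2 ζ hζ
  obtain ⟨g, hg, hgn⟩ := h3 ζ hζ
  refine ⟨f, g, 1 + ζ, hf, hg, hgn, (mul_le_mul_of_nonneg_right hfn (by positivity)).trans ?_⟩
  rwa [mul_one] at hle

/-- The functional norming `b` for the supremum norm defines `a`; that the minimal `L¹` norm for
`a` is at most one follows by testing the functional on near-minimizers for the sequence that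
norms `a`. -/
lemma exists_isExtremalPair_left (l : ℕ) {b : ℕ → ℝ} (hb : ∃ j ≤ l, b j ≠ 0) :
    ∃ a, IsExtremalPair l a b := by
  obtain ⟨Λ, h1, h2, h3, h4⟩ := exists_norming_functional l (normSeminorm ℝ C(Circle, ℂ))
    (fun f j => (abs_coeff_le_circleL1Seminorm f j).trans (circleL1Seminorm_le_norm _)) hb
  set a : ℕ → ℝ := fun j => Λ (circleChar ((l : ℤ) - j)) with ha
  have ha0 : ∃ j ≤ l, a j ≠ 0 := by
    by_contra! h
    refine h3.ne' (Finset.sum_eq_zero fun j hj => ?_)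
    rw [h (l - j) (Nat.sub_le l j), zero_mul]
  obtain ⟨b', k1, k2, k3⟩ := exists_norming_sequence l ha0
  have hle : cauchyCoeff l a b' ≤ 1 := by
    refine le_of_forall_pos_le_add fun η hη => ?_
    obtain ⟨g, hg, hgn⟩ := k3 η hη
    rw [← map_polyOnCircle_eq_cauchyCoeff h2 hg]
    refine (h1 _).trans ?_
    exact (ContinuousMap.norm_le _ (by positivity)).2 hgn
  refine ⟨a, h3, fun η hη => ?_⟩
  obtain ⟨ζ, hζ, hζle⟩ := exists_pos_add_mul_add_le 1 (cauchyCoeff l a b) hη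
  obtain ⟨f, hf, hfn⟩ := k2 ζ hζ
  obtain ⟨g, hg, hgn⟩ := h4 ζ hζ
  refine ⟨f, g, cauchyCoeff l a b + ζ, hf, hg,
    fun z => ((polyOnCircle g).norm_coe_le_norm z).trans hgn.le, ?_⟩
  rw [one_mul] at hζle
  exact (mul_le_mul_of_nonneg_right (hfn.trans (by linarith)) (by positivity)).trans hζle

/-! ### Asymptotics of the `L¹` norm and sharpness -/

lemma integral_abs_cos_add (α : ℝ) :
    ∫ s in (0 : ℝ)..(2 * Real.pi), |Real.cos (s + α)| = 4 := by
  have hper : Function.Periodic (fun s => |Real.cos s|) (2 * Real.pi) := fun s => by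
    simp only [Real.cos_add_two_pi]
  have hint : ∀ x y : ℝ, IntervalIntegrable (fun s => |Real.cos s|) MeasureTheory.volume x y :=
    fun x y => Real.continuous_cos.abs.intervalIntegrable x y
  rw [intervalIntegral.integral_comp_add_right (fun s => |Real.cos s|), zero_add, add_comm,
    hper.intervalIntegral_add_eq α (-(Real.pi / 2)),
    ← intervalIntegral.integral_add_adjacent_intervals (hint _ (Real.pi / 2)) (hint _ _)]
  have h1 : ∫ s in (-(Real.pi / 2))..(Real.pi / 2), |Real.cos s| =
      ∫ s in (-(Real.pi / 2))..(Real.pi / 2), Real.cos s := by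
    refine intervalIntegral.integral_congr fun s hs => abs_of_nonneg ?_
    rw [Set.uIcc_of_le (by linarith [Real.pi_pos])] at hs
    exact Real.cos_nonneg_of_mem_Icc hs
  have h2 : ∫ s in (Real.pi / 2)..(-(Real.pi / 2) + 2 * Real.pi), |Real.cos s| =
      ∫ s in (Real.pi / 2)..(-(Real.pi / 2) + 2 * Real.pi), -Real.cos s := by
    refine intervalIntegral.integral_congr fun s hs => abs_of_nonpos ?_
    rw [Set.uIcc_of_le (by linarith [Real.pi_pos])] at hs
    exact Real.cos_nonpos_of_pi_div_two_le_of_le hs.1 (by linarith [hs.2])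
  rw [h1, h2, intervalIntegral.integral_neg, integral_cos, integral_cos, Real.sin_add_two_pi,
    Real.sin_neg, Real.sin_pi_div_two]
  norm_num

lemma integral_abs_re_circleExp_mul (w : ℂ) :
    ∫ s in (0 : ℝ)..(2 * Real.pi), |((Circle.exp s : ℂ) * w).re| = 4 * ‖w‖ := by
  have h : ∀ s : ℝ, |((Circle.exp s : ℂ) * w).re| = ‖w‖ * |Real.cos (s + w.arg)| := by
    intro s
    have h1 : (Circle.exp s : ℂ) * w = ‖w‖ * Complex.exp ((s + w.arg : ℝ) * Complex.I) := by
      conv_lhs => rw [← Complex.norm_mul_exp_arg_mul_I w]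
      rw [Circle.coe_exp, Complex.ofReal_add, add_mul, Complex.exp_add]
      ring
    rw [h1, Complex.re_ofReal_mul, Complex.exp_ofReal_mul_I_re, abs_mul, abs_norm]
  simp_rw [h]
  rw [intervalIntegral.integral_const_mul, integral_abs_cos_add, mul_comm]

lemma exists_lipschitz_polyOnCircle (f : Polynomial ℝ) : ∃ L : ℝ, 0 ≤ L ∧ ∀ t s : ℝ,
    ‖polyOnCircle f (Circle.exp (t + s)) - polyOnCircle f (Circle.exp t)‖ ≤ L * |s| := by
  refine ⟨∑ k ∈ Finset.range (f.natDegree + 1), |f.coeff k| * k,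
    Finset.sum_nonneg fun k _ => by positivity, fun t s => ?_⟩
  rw [polyOnCircle_apply, polyOnCircle_apply, Polynomial.aeval_eq_sum_range,
    Polynomial.aeval_eq_sum_range, ← Finset.sum_sub_distrib, Finset.sum_mul]
  refine norm_sum_le_of_le _ fun k _ => ?_
  rw [← smul_sub, norm_smul, Real.norm_eq_abs, mul_assoc]
  refine mul_le_mul_of_nonneg_left ?_ (abs_nonneg _)
  have h : (Circle.exp (t + s) : ℂ) ^ k - (Circle.exp t : ℂ) ^ k =
      (Circle.exp t : ℂ) ^ k * ((Circle.exp (k * s) : ℂ) - 1) := by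
    rw [Circle.exp_add, Circle.coe_mul, mul_pow, ← nsmul_eq_mul, Circle.exp_nsmul, Circle.coe_pow]
    ring
  rw [h, norm_mul, norm_pow, Circle.norm_coe, one_pow, one_mul]
  refine (norm_circleExp_sub_one_le _).trans (le_of_eq ?_)
  rw [abs_mul, Nat.abs_cast]

lemma reTrigPoly_coeff {n : ℕ} {f : Polynomial ℝ} (hn : f.natDegree ≤ n) (t : ℝ) :
    reTrigPoly n n (fun j => (f.coeff j : ℂ)) t =
      ((Circle.exp (-(n * t)) : ℂ) * polyOnCircle f (Circle.exp t)).re := by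
  rw [reTrigPoly_eq le_rfl, ← Complex.conj_re, map_sum, polyOnCircle_apply,
    Polynomial.aeval_eq_sum_range' (Nat.lt_succ_of_le hn), Finset.mul_sum]
  congr 1
  refine Finset.sum_congr rfl fun j hj => ?_
  have hj : j ≤ n := by rw [Finset.mem_range] at hj; omega
  have hz : (Circle.exp t : ℂ) ≠ 0 := Circle.coe_ne_zero _
  rw [map_mul, map_pow, Complex.conj_ofReal, conj_circleExp, Circle.exp_neg, ← nsmul_eq_mul,
    Circle.exp_nsmul, Circle.coe_inv, Circle.coe_pow, Complex.real_smul,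
    inv_pow, show (Circle.exp t : ℂ) ^ n = (Circle.exp t : ℂ) ^ (n - j) * (Circle.exp t : ℂ) ^ j by
      rw [← pow_add, Nat.sub_add_cancel hj]]
  field_simp

/-- The mean of `|Re (e^{is} w)|` over all phases `s` is `2 / π * |w|`; phases are realized by
translations of length `O(1 / n)`, which hardly move the amplitude. -/
lemma exists_muNorm_coeff_le (f : Polynomial ℝ) : ∃ C : ℝ, ∀ n : ℕ, 0 < n → f.natDegree ≤ n →
    muNorm n (fun j => (f.coeff j : ℂ)) ≤ 4 * circleL1Seminorm (polyOnCircle f) + C / n := by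
  obtain ⟨L, hL0, hL⟩ := exists_lipschitz_polyOnCircle f
  refine ⟨4 * Real.pi ^ 2 * L, fun n hn hfn => ?_⟩
  have hnR : (0 : ℝ) < n := by exact_mod_cast hn
  set u : ℝ → ℝ := reTrigPoly n n (fun j => (f.coeff j : ℂ)) with hu
  have huc : Continuous u := continuous_reTrigPoly _ _ _
  have hup : Function.Periodic (fun t => |u t|) (2 * Real.pi) := fun t => by
    simp only [hu, reTrigPoly_periodic le_rfl _ t]
  set w : ℝ → ℂ := fun t => (Circle.exp (-(n * t)) : ℂ) * polyOnCircle f (Circle.exp t) with hw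
  have hwc : Continuous w :=
    (continuous_circleExp_coe.comp (by fun_prop : Continuous fun t : ℝ => -(n * t))).mul
      (by fun_prop)
  have hjc : Continuous fun x : ℝ × ℝ => |((Circle.exp x.1 : ℂ) * w x.2).re| :=
    (Complex.continuous_re.comp ((continuous_circleExp_coe.comp continuous_fst).mul
      (hwc.comp continuous_snd))).abs
  -- A translation by `-s / n` multiplies the carrier by `e^{is}` and moves the amplitude by at most
  -- `2 π L / n`.
  have hshift : ∀ s ∈ Set.Icc (0 : ℝ) (2 * Real.pi), muNorm n (fun j => (f.coeff j : ℂ)) ≤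
      (∫ t in (0 : ℝ)..(2 * Real.pi), |((Circle.exp s : ℂ) * w t).re|) +
        4 * Real.pi ^ 2 * L / n := by
    intro s hs
    have h1 : muNorm n (fun j => (f.coeff j : ℂ)) =
        ∫ t in (0 : ℝ)..(2 * Real.pi), |u (t + -(s / n))| := by
      rw [intervalIntegral.integral_comp_add_right (fun t => |u t|), zero_add, add_comm,
        hup.intervalIntegral_add_eq _ 0, zero_add]
      rfl
    have h2 : ∀ t, |u (t + -(s / n))| ≤ |((Circle.exp s : ℂ) * w t).re| +
        L * (2 * Real.pi / n) := by
      intro t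
      have h3 : u (t + -(s / n)) = ((Circle.exp s : ℂ) * w t).re +
          ((Circle.exp s : ℂ) * ((Circle.exp (-(n * t)) : ℂ) *
            (polyOnCircle f (Circle.exp (t + -(s / n))) - polyOnCircle f (Circle.exp t)))).re := by
        rw [hu, reTrigPoly_coeff hfn, ← Complex.add_re, hw, ← mul_add, ← mul_add,
          add_sub_cancel, show -(n * (t + -(s / n))) = s + -(n * t) by field_simp; ring,
          Circle.exp_add s, Circle.coe_mul, mul_assoc]
      rw [h3]
      refine (abs_add_le _ _).trans (add_le_add le_rfl ((Complex.abs_re_le_norm _).trans ?_))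
      rw [norm_mul, norm_mul, Circle.norm_coe, Circle.norm_coe, one_mul, one_mul]
      refine (hL _ _).trans (mul_le_mul_of_nonneg_left ?_ hL0)
      rw [abs_neg, abs_div, Nat.abs_cast, abs_of_nonneg hs.1]
      exact div_le_div_of_nonneg_right hs.2 hnR.le
    have hc : Continuous fun t => |((Circle.exp s : ℂ) * w t).re| :=
      (Complex.continuous_re.comp (continuous_const.mul hwc)).abs
    have hc' : Continuous fun t => |((Circle.exp s : ℂ) * w t).re| + L * (2 * Real.pi / n) :=
      hc.add continuous_const
    rw [h1]
    refine (intervalIntegral.integral_mono_on (μ := MeasureTheory.volume) Real.two_pi_pos.le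
      (Continuous.intervalIntegrable (by fun_prop) _ _)
      (hc'.intervalIntegrable _ _) fun t _ => h2 t).trans (le_of_eq ?_)
    rw [intervalIntegral.integral_add (hc.intervalIntegrable _ _)
      (continuous_const.intervalIntegrable _ _), intervalIntegral.integral_const, smul_eq_mul]
    ring
  have hIc : Continuous fun s : ℝ =>
      ∫ t in (0 : ℝ)..(2 * Real.pi), |((Circle.exp s : ℂ) * w t).re| :=
    intervalIntegral.continuous_parametric_intervalIntegral_of_continuous' hjc _ _
  have hIc' : Continuous fun s : ℝ =>
      (∫ t in (0 : ℝ)..(2 * Real.pi), |((Circle.exp s : ℂ) * w t).re|) +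
        4 * Real.pi ^ 2 * L / n := hIc.add continuous_const
  have hmean := intervalIntegral.integral_mono_on (μ := MeasureTheory.volume) Real.two_pi_pos.le
    (continuous_const.intervalIntegrable _ _)
    (hIc'.intervalIntegrable _ _) hshift
  have hswap : ∫ s in (0 : ℝ)..(2 * Real.pi), ∫ t in (0 : ℝ)..(2 * Real.pi),
      |((Circle.exp s : ℂ) * w t).re| =
      4 * ∫ t in (0 : ℝ)..(2 * Real.pi), ‖polyOnCircle f (Circle.exp t)‖ := by
    rw [MeasureTheory.intervalIntegral_intervalIntegral_swap]
    · simp_rw [integral_abs_re_circleExp_mul]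
      rw [intervalIntegral.integral_const_mul]
      simp [hw]
    · refine MeasureTheory.IntegrableOn.mono_set
        (hjc.continuousOn.integrableOn_compact (isCompact_uIcc.prod isCompact_uIcc))
        (Set.prod_mono Set.uIoc_subset_uIcc Set.uIoc_subset_uIcc)
  rw [intervalIntegral.integral_add (hIc.intervalIntegrable _ _)
      (continuous_const.intervalIntegrable _ _), intervalIntegral.integral_const,
    intervalIntegral.integral_const, hswap, smul_eq_mul, smul_eq_mul, sub_zero] at hmean
  rw [circleL1Seminorm_apply]
  refine le_of_mul_le_mul_left (hmean.trans (le_of_eq ?_)) Real.two_pi_pos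
  field_simp

lemma cauchyCoeff_le_productNorm {l n : ℕ} (hln : l ≤ n) (μ τ : ℕ → ℝ) :
    cauchyCoeff l μ τ ≤ productNorm l n (fun j => (μ j : ℂ)) (fun j => (τ j : ℂ)) := by
  refine le_trans (le_of_eq ?_) ((le_abs_self _).trans
    (abs_le_supNorm (continuous_reTrigPoly _ _ _) (reTrigPoly_periodic hln _) 0))
  rw [reTrigPoly_eq hln, cauchyCoeff, Complex.re_sum]
  refine Finset.sum_congr rfl fun j _ => ?_
  rw [Circle.exp_zero, Circle.coe_one, one_pow, mul_one, ← Complex.ofReal_mul, Complex.ofReal_re]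

lemma exists_ne_zero_of_cauchyCoeff_pos {l : ℕ} {a b : ℕ → ℝ} (h : 0 < cauchyCoeff l a b) :
    (∃ j ≤ l, a j ≠ 0) ∧ ∃ j ≤ l, b j ≠ 0 := by
  obtain ⟨j, hj, hne⟩ := Finset.exists_ne_zero_of_sum_ne_zero h.ne'
  rw [Finset.mem_range] at hj
  exact ⟨⟨l - j, Nat.sub_le l j, left_ne_zero_of_mul hne⟩,
    ⟨j, by omega, right_ne_zero_of_mul hne⟩⟩

/-- The quotient whose limit is taken in `AsymptoticallySharp`. -/
noncomputable def sharpnessQuotient (l n : ℕ) (μ τ : ℕ → ℝ) : ℝ :=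
  4 * productNorm l n (fun j => (μ j : ℂ)) (fun j => (τ j : ℂ)) /
    (muNorm n (fun j => (μ j : ℂ)) * tauNorm n (fun j => (τ j : ℂ)))

/-- No choice of coefficients makes the limit superior exceed one. -/
lemma eventually_sharpnessQuotient_le (l : ℕ) {δ : ℝ} (hδ : 0 < δ) :
    ∀ᶠ n in Filter.atTop, ∀ μ τ : ℕ → ℝ, sharpnessQuotient l n μ τ ≤ 1 + δ := by
  obtain ⟨n₀, h₀⟩ := four_mul_productNorm_le_one_add_mul l hδ
  filter_upwards [Filter.eventually_ge_atTop n₀] with n hn μ τ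
  refine div_le_of_le_mul₀ (mul_nonneg (l1Norm_nonneg _) (supNorm_nonneg _)) (by positivity) ?_
  rw [← mul_assoc]
  exact h₀ n hn _ _

lemma IsExtremalPair.eventually_exists_le_sharpnessQuotient {l : ℕ} {a b : ℕ → ℝ}
    (h : IsExtremalPair l a b) {ε : ℝ} (hε : 0 < ε) (hε1 : ε < 1) :
    ∀ᶠ n in Filter.atTop, ∃ μ τ : ℕ → ℝ, (∀ j ≤ l, μ j = a j ∧ τ j = b j) ∧
      1 - ε ≤ sharpnessQuotient l n μ τ := by
  obtain ⟨hpos, h⟩ := h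
  set d := cauchyCoeff l a b with hd
  obtain ⟨f, g, S, hf, hg, hS, hfS⟩ := h (ε * d / 2) (by positivity)
  obtain ⟨C, hC⟩ := exists_muNorm_coeff_le f
  obtain ⟨⟨i, hi, hai⟩, ⟨k, hk, hbk⟩⟩ := exists_ne_zero_of_cauchyCoeff_pos hpos
  have hS0 : 0 ≤ S := (norm_nonneg _).trans (hS 1)
  have hlim : ∀ᶠ n : ℕ in Filter.atTop, C * S / n < 2 * ε * d :=
    (tendsto_const_div_atTop_nhds_zero_nat (C * S)).eventually (gt_mem_nhds (by positivity))
  filter_upwards [hlim, Filter.eventually_gt_atTop l, Filter.eventually_ge_atTop f.natDegree,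
    Filter.eventually_ge_atTop g.natDegree] with n hn hln hfn hgn
  refine ⟨f.coeff, g.coeff, fun j hj => ⟨hf j hj, hg j hj⟩, ?_⟩
  have hmu := hC n (by omega) hfn
  have hmu0 : 0 < muNorm n (fun j => (f.coeff j : ℂ)) := by
    refine lt_of_lt_of_le ?_ (pi_mul_norm_le_l1Norm (j := i) (by omega) _)
    rw [hf i hi]
    have := Real.pi_pos
    have : (0 : ℝ) < ‖(a i : ℂ)‖ := by simpa using hai
    positivity
  have htau : tauNorm n (fun j => (g.coeff j : ℂ)) ≤ S := by
    refine supNorm_le fun t => ?_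
    simp only [Complex.conj_ofReal]
    rw [reTrigPoly_coeff hgn]
    refine (Complex.abs_re_le_norm _).trans ?_
    rw [norm_mul, Circle.norm_coe, one_mul]
    exact hS _
  have htau0 : 0 < tauNorm n (fun j => (g.coeff j : ℂ)) := by
    have h1 := norm_le_two_mul_of_abs_reTrigPoly_le (j := k) (by omega)
      (abs_reTrigPoly_le_tauNorm n fun j => (g.coeff j : ℂ))
    rw [RCLike.norm_conj, hg k hk] at h1
    have : (0 : ℝ) < ‖(b k : ℂ)‖ := by simpa using hbk
    linarith
  have hprod : d ≤ productNorm l n (fun j => (f.coeff j : ℂ)) (fun j => (g.coeff j : ℂ)) := by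
    refine le_trans (le_of_eq ?_) (cauchyCoeff_le_productNorm hln.le _ _)
    refine Finset.sum_congr rfl fun j hj => ?_
    rw [Finset.mem_range] at hj
    rw [hf _ (Nat.sub_le l j), hg j (by omega)]
  have hden : muNorm n (fun j => (f.coeff j : ℂ)) * tauNorm n (fun j => (g.coeff j : ℂ)) ≤
      4 * d * (1 + ε) := by
    calc _ ≤ (4 * circleL1Seminorm (polyOnCircle f) + C / n) * S :=
          mul_le_mul hmu htau htau0.le (hmu0.le.trans hmu)
      _ = 4 * (circleL1Seminorm (polyOnCircle f) * S) + C * S / n := by ring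
      _ ≤ 4 * d * (1 + ε) := by linarith
  rw [sharpnessQuotient, le_div_iff₀ (mul_pos hmu0 htau0)]
  have h1 := mul_le_mul_of_nonneg_left hden (sub_nonneg.2 hε1.le)
  have h2 : (1 - ε) * (4 * d * (1 + ε)) ≤ 4 * d := by nlinarith [mul_pos hpos (sq_pos_of_pos hε)]
  linarith

/-- Coefficients that nearly maximize the truncated quotient for every degree are a diagonal choice
that works for all tolerances simultaneously. -/
lemma IsExtremalPair.asymptoticallySharp {l : ℕ} {a b : ℕ → ℝ} (h : IsExtremalPair l a b) :
    AsymptoticallySharp l (fun j => a j) (fun j => b j) := by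
  have hchoice : ∀ n : ℕ, ∃ x : (ℕ → ℝ) × (ℕ → ℝ), (∀ j ≤ l, x.1 j = a j ∧ x.2 j = b j) ∧
      ∀ μ τ : ℕ → ℝ, (∀ j ≤ l, μ j = a j ∧ τ j = b j) →
        min (sharpnessQuotient l n μ τ) 1 ≤
          min (sharpnessQuotient l n x.1 x.2) 1 + 1 / ((n : ℝ) + 1) := by
    intro n
    -- Truncation at one makes the set of attainable values bounded for every `n`.
    set Y : Set ℝ := {y | ∃ x : (ℕ → ℝ) × (ℕ → ℝ), (∀ j ≤ l, x.1 j = a j ∧ x.2 j = b j) ∧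
      min (sharpnessQuotient l n x.1 x.2) 1 = y} with hY
    have hne : Y.Nonempty := ⟨_, (a, b), fun j _ => ⟨rfl, rfl⟩, rfl⟩
    have hbdd : BddAbove Y := ⟨1, by rintro _ ⟨x, _, rfl⟩; exact min_le_right _ _⟩
    obtain ⟨_, ⟨x, hx, rfl⟩, hlt⟩ :=
      exists_lt_of_lt_csSup hne (sub_lt_self (sSup Y) (Nat.one_div_pos_of_nat (α := ℝ) (n := n)))
    refine ⟨x, hx, fun μ τ hμτ => ?_⟩
    have := le_csSup hbdd (show min (sharpnessQuotient l n μ τ) 1 ∈ Y from ⟨(μ, τ), hμτ, rfl⟩)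
    linarith
  choose x hx hmax using hchoice
  refine ⟨fun n => (x n).1, fun n => (x n).2, fun n j => hx n j (by omega), ?_⟩
  change Filter.Tendsto (fun n => sharpnessQuotient l n (x n).1 (x n).2) Filter.atTop (𝓝 1)
  refine tendsto_order.2 ⟨fun c hc => ?_, fun c hc => ?_⟩
  · set ε : ℝ := min (1 - c) 1 / 2 with hε
    have hε0 : 0 < ε := by
      have : 0 < 1 - c := by linarith
      positivity
    have hε1 : ε < 1 := by
      have := min_le_right (1 - c) 1
      linarith
    have hεc : 2 * ε ≤ 1 - c := by
      have := min_le_left (1 - c) 1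
      linarith
    have hlim : ∀ᶠ n : ℕ in Filter.atTop, 1 / ((n : ℝ) + 1) < ε :=
      tendsto_one_div_add_atTop_nhds_zero_nat.eventually (gt_mem_nhds hε0)
    filter_upwards [hlim, h.eventually_exists_le_sharpnessQuotient hε0 hε1] with n hn hex
    obtain ⟨μ, τ, hμτ, hle⟩ := hex
    have h1 := hmax n μ τ hμτ
    have h2 : 1 - ε ≤ min (sharpnessQuotient l n μ τ) 1 := le_min hle (by linarith)
    have h3 := min_le_left (sharpnessQuotient l n (x n).1 (x n).2) 1
    linarith
  · filter_upwards [eventually_sharpnessQuotient_le l (half_pos (sub_pos.2 hc))] with n hn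
    have := hn (x n).1 (x n).2
    linarith

lemma exists_ne_zero_ofNat {l : ℕ} {a : Fin (l + 1) → ℝ} (ha : a ≠ 0) :
    ∃ j ≤ l, a (Fin.ofNat (l + 1) j) ≠ 0 := by
  obtain ⟨i, hi⟩ := Function.ne_iff.1 ha
  refine ⟨i, by omega, ?_⟩
  rw [Fin.ofNat_val_eq_self]
  exact hi

theorem mainTheorem5 (l : ℕ) :
    (∀ ε : ℝ, 0 < ε → ∀ M : ℝ, ∃ n₀ : ℕ, l ≤ n₀ ∧ ∀ n : ℕ, n₀ ≤ n →
      ∀ μ τ : ℕ → ℂ, (∀ j : ℕ, j ≤ l → ‖μ j‖ ≤ M) →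
        4 * productNorm l n μ τ ≤ (muNorm n μ + ε) * tauNorm n τ) ∧
    (∀ a : Fin (l + 1) → ℝ, a ≠ 0 → ∃ b : Fin (l + 1) → ℝ, AsymptoticallySharp l a b) ∧
    (∀ b : Fin (l + 1) → ℝ, b ≠ 0 → ∃ a : Fin (l + 1) → ℝ, AsymptoticallySharp l a b) := by
  refine ⟨fun ε hε M => four_mul_productNorm_le l hε M, fun a ha => ?_, fun b hb => ?_⟩
  · obtain ⟨b, hab⟩ := exists_isExtremalPair_right l (exists_ne_zero_ofNat ha)
    have h := hab.asymptoticallySharp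
    simp only [Fin.ofNat_val_eq_self] at h
    exact ⟨_, h⟩
  · obtain ⟨a, hab⟩ := exists_isExtremalPair_left l (exists_ne_zero_ofNat hb)
    have h := hab.asymptoticallySharp
    simp only [Fin.ofNat_val_eq_self] at h
    exact ⟨_, h⟩
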